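/- Work in continuous logic. Let $L_N$ be the language of real Hilbert spaces (inner product, metric, linear structure; the sorts are the closed balls around $0$) with an additional unary predicate $d_N$. $T_0$ is the $L_N$-theory of Hilbert spaces with $d_N\colon H\to[0,1]$ satisfying $\sup_x\min\{1\dot-d_N(x),\ \inf_y\max\{|d_N(x)-\|x-y\||,\ d_N(y)\}\}=0$ and $\sup_x\sup_y\,[d_N(y)-\|x-y\|-d_N(x)]\le 0$ (so $d_N$ is a distance to a set of "black" points, truncated at $1$). $T_N$ is the model companion of $T_0\cup\{d_N(0)=0\}$, that is, the theory of its existentially closed models. Let $(\mathcal U,d_N)\models T_N$ be a $\kappa$-universal domain ($\kappa$-saturated and strongly $\kappa$-homogeneous, with $\kappa>2^{\aleph_0}$); a subset of $\mathcal U$ is small if its density character is less than $\kappa$. Let $\operatorname{acl}_N$ denote the algebraic closure in $L_N$: $x\in\operatorname{acl}_N(X)$ iff the set of realizations of $\operatorname{tp}_N(x/X)$ in $\mathcal U$ is compact. For small $A,B,C$, say that $B$ is $*$-independent from $C$ over $A$, written $B\perp^*_A C$, if $P_{\operatorname{acl}_N(A\cup C)}(x)=P_{\operatorname{acl}_N(A)}(x)$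 for every $x\in\operatorname{acl}_N(A\cup B)$, where $P$ denotes orthogonal projection. **Strong finite character.** Let $A\subset C\subset\mathcal U$ be small sets and let $\bar b$ be a finite tuple of $\mathcal U$ with $\bar b\not\perp^*_A C$. Then there is an $L_N$-formula $\chi(\bar x)$ with parameters in $C$ such that the condition $\chi=0$ belongs to $\operatorname{tp}_N(\bar b/C)$ and every tuple $\bar a$ of $\mathcal U$ with $\chi(\bar a)=0$ satisfies $\bar a\not\perp^*_A C$. -/

import Mathlib

universe u

namespace HilbertGeneric

/-! ## The language `L_N` of (real) Hilbert spaces with a predicate `d_N`, in continuous logic -/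

/-- Terms in `n` free variables: built from variables and `0` by addition and by the scalar
multiplications `λ_r`. -/
inductive Term (n : ℕ) : Type
  | var (i : Fin n) : Term n
  | zero : Term n
  | add (s t : Term n) : Term n
  | smul (r : ℝ) (t : Term n) : Term n

/-- Formulas of continuous logic in `n` free variables. The atomic formulas are the inner product,
the metric and `d_N` of terms; the connectives are the continuous real functions of finitely many
real variables; the quantifiers `sup`, `inf` range over the sorts, that is, over the closed balls
of radius `k` around `0`. -/
inductive Formula : ℕ → Type
  | inner {n : ℕ} (s t : Term n) : Formula n
  | dist {n : ℕ} (s t : Term n) : Formula n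
  | dN {n : ℕ} (t : Term n) : Formula n
  | conn {n k : ℕ} (c : C(Fin k → ℝ, ℝ)) (φ : Fin k → Formula n) : Formula n
  | sup {n : ℕ} (k : ℕ) (φ : Formula (n + 1)) : Formula n
  | inf {n : ℕ} (k : ℕ) (φ : Formula (n + 1)) : Formula n

/-- Formulas without quantifiers. -/
inductive Formula.IsQF : {n : ℕ} → Formula n → Prop
  | inner {n : ℕ} (s t : Term n) : Formula.IsQF (Formula.inner s t)
  | dist {n : ℕ} (s t : Term n) : Formula.IsQF (Formula.dist s t)
  | dN {n : ℕ} (t : Term n) : Formula.IsQF (Formula.dN t)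
  | conn {n k : ℕ} (c : C(Fin k → ℝ, ℝ)) (φ : Fin k → Formula n)
      (h : ∀ i, Formula.IsQF (φ i)) : Formula.IsQF (Formula.conn c φ)

/-- Existential formulas: a block of `inf`-quantifiers in front of a quantifier-free formula. -/
inductive Formula.IsExistential : {n : ℕ} → Formula n → Prop
  | qf {n : ℕ} (φ : Formula n) (h : φ.IsQF) : Formula.IsExistential φ
  | inf {n : ℕ} (k : ℕ) (φ : Formula (n + 1)) (h : Formula.IsExistential φ) :
      Formula.IsExistential (Formula.inf k φ)

section Semantics

variable {H : Type u} [NormedAddCommGroup H] [InnerProductSpace ℝ H]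

/-- The value of a term at a tuple. -/
def Term.eval {n : ℕ} (v : Fin n → H) : Term n → H
  | .var i => v i
  | .zero => 0
  | .add s t => s.eval v + t.eval v
  | .smul r t => r • t.eval v

/-- The value of a formula at a tuple, in the structure `(H, d_N)`. -/
noncomputable def Formula.eval (d : H → ℝ) : {n : ℕ} → Formula n → (Fin n → H) → ℝ
  | _, .inner s t, v => Inner.inner ℝ (s.eval v) (t.eval v)
  | _, .dist s t, v => Dist.dist (s.eval v) (t.eval v)
  | _, .dN t, v => d (t.eval v)
  | _, .conn c φ, v => c (fun i => (φ i).eval d v)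
  | n, .sup k φ, v =>
      ⨆ y : Metric.closedBall (0 : H) k, φ.eval d (Fin.snoc (α := fun _ : Fin (n + 1) => H) v y)
  | n, .inf k φ, v =>
      ⨅ y : Metric.closedBall (0 : H) k, φ.eval d (Fin.snoc (α := fun _ : Fin (n + 1) => H) v y)

end Semantics

/-! ## The theories `T_0` and `T_N` -/

/-- `(H, d_N)` is a model of `T_0`: `d_N` takes values in `[0, 1]` and satisfies
`sup_x min {1 ∸ d_N(x), inf_y max {|d_N(x) - ‖x - y‖|, d_N(y)}} = 0` and
`sup_x sup_y (d_N(y) - ‖x - y‖ - d_N(x)) ≤ 0`. -/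
structure IsModelT0 {H : Type u} [NormedAddCommGroup H] (d : H → ℝ) : Prop where
  mem_Icc : ∀ x, d x ∈ Set.Icc (0 : ℝ) 1
  witness : ∀ x, min (1 - d x) (⨅ y, max |d x - ‖x - y‖| (d y)) = 0
  lipschitz : ∀ x y, d y - ‖x - y‖ - d x ≤ 0

/-- The class `K_0` of the models of `T_0` in which `0` is black. -/
def IsK0 {H : Type u} [NormedAddCommGroup H] (d : H → ℝ) : Prop :=
  IsModelT0 d ∧ d 0 = 0

/-- `(H, d_N)` is existentially closed in `K_0`: existential formulas do not change their values
at tuples of `H` when `(H, d_N)` is extended inside `K_0`. -/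
def IsEC {H : Type u} [NormedAddCommGroup H] [InnerProductSpace ℝ H] (d : H → ℝ) : Prop :=
  IsK0 d ∧
    ∀ (K : Type u) [NormedAddCommGroup K] [InnerProductSpace ℝ K] [CompleteSpace K] (e : K → ℝ),
      IsK0 e → ∀ f : H →ₗᵢ[ℝ] K, (∀ x, e (f x) = d x) →
        ∀ (n : ℕ) (φ : Formula n), φ.IsExistential →
          ∀ v : Fin n → H, φ.eval d v = φ.eval e (fun i => f (v i))

/-- The sentences (conditions `φ = 0`) of the model companion `T_N` of `T_0 ∪ {d_N(0) = 0}`: those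
that hold in all existentially closed models. -/
def theoryTN : Set (Formula 0) :=
  {φ | ∀ (H : Type u) [NormedAddCommGroup H] [InnerProductSpace ℝ H] [CompleteSpace H]
    (d : H → ℝ), IsEC d → φ.eval d ![] = 0}

/-- `(H, d_N)` is a model of `T_N`. -/
def IsModelTN {H : Type u} [NormedAddCommGroup H] [InnerProductSpace ℝ H] (d : H → ℝ) : Prop :=
  IsK0 d ∧ ∀ φ ∈ theoryTN.{u}, φ.eval d ![] = 0

/-! ## Types, universal domains, algebraic closure and independence -/

section Domain

variable {H : Type u} [NormedAddCommGroup H] [InnerProductSpace ℝ H]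

/-- An `L_N(A)`-formula in `n` free variables: a formula whose remaining variables are replaced by
parameters from `A`. -/
structure ParamFormula (A : Set H) (n : ℕ) where
  arity : ℕ
  formula : Formula (n + arity)
  param : Fin arity → H
  param_mem : ∀ j, param j ∈ A

/-- The value of an `L_N(A)`-formula at a tuple. -/
noncomputable def ParamFormula.eval (d : H → ℝ) {A : Set H} {n : ℕ} (χ : ParamFormula A n)
    (b : Fin n → H) : ℝ :=
  χ.formula.eval d (Fin.append b χ.param)

/-- `b ⊨ χ`, that is, `b` satisfies the condition `χ = 0`. -/
def Realizes (d : H → ℝ) {A : Set H} {n : ℕ} (b : Fin n → H) (χ : ParamFormula A n) : Prop :=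
  χ.eval d b = 0

/-- The type `tp_N(b/A)`. -/
def tpN (d : H → ℝ) (A : Set H) {n : ℕ} (b : Fin n → H) : Set (ParamFormula A n) :=
  {χ | Realizes d b χ}

/-- `κ`-saturation: over fewer than `κ` parameters, a set of conditions on a tuple of variables of
sort `B_r(H)` is satisfiable if all its finite subsets are. -/
def IsSaturated (d : H → ℝ) (κ : Cardinal.{u}) : Prop :=
  ∀ A : Set H, Cardinal.mk A < κ → ∀ (n r : ℕ) (Γ : Set (ParamFormula A n)),
    (∀ Γ₀ : Set (ParamFormula A n), Γ₀ ⊆ Γ → Γ₀.Finite →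
      ∃ b : Fin n → H, (∀ i, ‖b i‖ ≤ r) ∧ ∀ χ ∈ Γ₀, Realizes d b χ) →
    ∃ b : Fin n → H, (∀ i, ‖b i‖ ≤ r) ∧ ∀ χ ∈ Γ, Realizes d b χ

/-- Strong `κ`-homogeneity: an elementary map defined on fewer than `κ` elements extends to an
automorphism. -/
def IsStronglyHomogeneous (d : H → ℝ) (κ : Cardinal.{u}) : Prop :=
  ∀ A : Set H, Cardinal.mk A < κ → ∀ f : H → H,
    (∀ (n : ℕ) (φ : Formula n) (v : Fin n → H), (∀ i, v i ∈ A) →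
      φ.eval d (fun i => f (v i)) = φ.eval d v) →
    ∃ σ : H ≃ₗᵢ[ℝ] H, (∀ x, d (σ x) = d x) ∧ ∀ x ∈ A, σ x = f x

/-- `(H, d_N)` is a `κ`-universal domain (monster model) of `T_N`. -/
structure IsUniversalDomain (d : H → ℝ) (κ : Cardinal.{u}) : Prop where
  model : IsModelTN d
  continuum_lt : Cardinal.continuum < κ
  saturated : IsSaturated d κ
  homogeneous : IsStronglyHomogeneous d κ

/-- Small sets: those of density character less than `κ`. -/
def IsSmall (κ : Cardinal.{u}) (A : Set H) : Prop :=
  ∃ D : Set H, D ⊆ A ∧ A ⊆ closure D ∧ Cardinal.mk D < κ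

/-- The algebraic closure `acl_N(A)` in a universal domain: the elements whose type over `A` has a
compact set of realizations. -/
def aclN (d : H → ℝ) (A : Set H) : Set H :=
  {x | IsCompact {y : H | tpN d A ![y] = tpN d A ![x]}}

/-- The orthogonal projection onto the closed subspace generated by `S`. -/
noncomputable def proj [CompleteSpace H] (S : Set H) (x : H) : H :=
  (Submodule.span ℝ S).topologicalClosure.starProjection x

/-- `B` is `*`-independent from `C` over `A`: for all `x ∈ acl_N(B ∪ A)`, the projections of `x` on
`acl_N(A ∪ C)` and on `acl_N(A)` agree. -/
def StarIndep [CompleteSpace H] (d : H → ℝ) (A B C : Set H) : Prop :=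
  ∀ x ∈ aclN d (B ∪ A), proj (aclN d (A ∪ C)) x = proj (aclN d A) x

end Domain

end HilbertGeneric

/-! In a universal domain, types over a small set are orbits of automorphisms. Hence `aclN d A` is
the set of vectors whose orbit under `autGroup d A` is totally bounded, and this set is a closed
subspace (`aclN_eq_almostPeriodic`). Dependence of `b` thus yields `x` in acl(Ab) and `c` in acl(C),
orthogonal to acl(A), with ⟪x, c⟫ = s > 0.

The formula must force the same on every solution `a`. By compactness, the orbits of `x` and `c` are
isolated up to `η` by single formulas (`exists_isDef_near_orbit`). The condition says that
approximately some `z`, `z'` satisfy these formulas with ⟪z, z'⟫ ≥ s, and that the solutions of the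
first formula contain no large separated set. For a solution `a`, the orbit of `z` over `Aa` then
has a finite net at a fixed scale only, so `z` need not be algebraic.

The gap is closed by `exists_almostPeriodic_near`: a vector whose orbit has a finite `ε`-net lies
within `ε` of a vector with totally bounded orbit. After projecting, the claim is that such a vector
orthogonal to all totally bounded orbits has norm at most `ε`. Averaging the rank-one operators of
its orbit, by norm minimization in a convex hull, gives an invariant compact operator. Its values
have totally bounded orbits, yet they are orthogonal to all such vectors, so it vanishes; a norm
above `ε` would make its quadratic form positive somewhere on the net. -/

namespace HilbertGeneric

/-! ### Vectors with totally bounded orbit under a group of isometries -/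

section AlmostPeriodic

open scoped TensorProduct

variable {H : Type u} [NormedAddCommGroup H] [InnerProductSpace ℝ H]

/-- The orbit of `x` under a group of linear isometries. -/
def orbit (G : Subgroup (H ≃ₗᵢ[ℝ] H)) (x : H) : Set H :=
  {y | ∃ g ∈ G, g x = y}

lemma mem_orbit_self (G : Subgroup (H ≃ₗᵢ[ℝ] H)) (x : H) : x ∈ orbit G x :=
  ⟨1, G.one_mem, rfl⟩

lemma orbit_apply (G : Subgroup (H ≃ₗᵢ[ℝ] H)) {g : H ≃ₗᵢ[ℝ] H} (hg : g ∈ G) (x : H) :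
    orbit G (g x) = orbit G x := by
  ext y
  constructor
  · rintro ⟨h, hh, rfl⟩
    exact ⟨h * g, G.mul_mem hh hg, rfl⟩
  · rintro ⟨h, hh, rfl⟩
    refine ⟨h * g⁻¹, G.mul_mem hh (G.inv_mem hg), ?_⟩
    change h (g.symm (g x)) = h x
    simp

/-- The closed subspace of the vectors whose orbit is totally bounded. -/
def almostPeriodic (G : Subgroup (H ≃ₗᵢ[ℝ] H)) : Submodule ℝ H where
  carrier := {x | TotallyBounded (orbit G x)}
  zero_mem' := by
    refine (Set.finite_singleton (0 : H)).totallyBounded.subset ?_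
    rintro y ⟨g, -, rfl⟩
    simp
  add_mem' := by
    intro x y hx hy
    change TotallyBounded (orbit G (x + y))
    rw [Metric.totallyBounded_iff]
    intro ε hε
    obtain ⟨s, hs, hxs⟩ := Metric.totallyBounded_iff.1 hx (ε / 2) (half_pos hε)
    obtain ⟨t, ht, hyt⟩ := Metric.totallyBounded_iff.1 hy (ε / 2) (half_pos hε)
    refine ⟨_, hs.image2 (· + ·) ht, ?_⟩
    rintro _ ⟨g, hg, rfl⟩
    have h1 := hxs ⟨g, hg, rfl⟩
    have h2 := hyt ⟨g, hg, rfl⟩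
    simp only [Set.mem_iUnion, Metric.mem_ball, exists_prop] at h1 h2 ⊢
    obtain ⟨a, ha, hga⟩ := h1
    obtain ⟨b, hb, hgb⟩ := h2
    refine ⟨a + b, ⟨a, ha, b, hb, rfl⟩, ?_⟩
    rw [map_add]
    linarith [dist_add_add_le (g x) (g y) a b]
  smul_mem' := by
    intro c x hx
    have h := TotallyBounded.image (f := fun p : H => c • p) hx (uniformContinuous_const_smul c)
    refine h.subset ?_
    rintro z ⟨g, hg, rfl⟩
    exact ⟨g x, ⟨g, hg, rfl⟩, by simp⟩

lemma mem_almostPeriodic {G : Subgroup (H ≃ₗᵢ[ℝ] H)} {x : H} :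
    x ∈ almostPeriodic G ↔ TotallyBounded (orbit G x) := Iff.rfl

lemma apply_mem_almostPeriodic {G : Subgroup (H ≃ₗᵢ[ℝ] H)} {g : H ≃ₗᵢ[ℝ] H} (hg : g ∈ G) {x : H}
    (hx : x ∈ almostPeriodic G) : g x ∈ almostPeriodic G := by
  rw [mem_almostPeriodic, orbit_apply G hg]
  exact hx

lemma almostPeriodic_anti {G G' : Subgroup (H ≃ₗᵢ[ℝ] H)} (h : G ≤ G') :
    almostPeriodic G' ≤ almostPeriodic G := by
  intro x hx
  refine TotallyBounded.subset ?_ hx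
  rintro y ⟨g, hg, rfl⟩
  exact ⟨g, h hg, rfl⟩

lemma isClosed_almostPeriodic (G : Subgroup (H ≃ₗᵢ[ℝ] H)) :
    IsClosed (almostPeriodic G : Set H) := by
  refine isClosed_of_closure_subset fun x hx => ?_
  change TotallyBounded (orbit G x)
  rw [Metric.totallyBounded_iff]
  intro ε hε
  obtain ⟨y, hy, hxy⟩ := Metric.mem_closure_iff.1 hx (ε / 2) (half_pos hε)
  obtain ⟨t, ht, hyt⟩ := Metric.totallyBounded_iff.1 (mem_almostPeriodic.1 hy) (ε / 2) (half_pos hε)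
  refine ⟨t, ht, ?_⟩
  rintro z ⟨g, hg, rfl⟩
  have := hyt ⟨g, hg, rfl⟩
  simp only [Set.mem_iUnion, Metric.mem_ball, exists_prop] at this ⊢
  obtain ⟨c, hc, hgc⟩ := this
  refine ⟨c, hc, ?_⟩
  have h1 : dist (g x) (g y) = dist x y := g.dist_map x y
  linarith [dist_triangle (g x) (g y) c]

/-- The operator `w ↦ ⟪u, w⟫ v` attached to the tensor `u ⊗ v`. -/
noncomputable def tensorOpₗ : H ⊗[ℝ] H →ₗ[ℝ] (H →L[ℝ] H) :=
  TensorProduct.lift (LinearMap.mk₂ ℝ (fun u v : H => (innerSL ℝ u).smulRight v)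
    (by intros; ext; simp [add_smul])
    (by intros; ext; simp [mul_smul])
    (by intros; ext; simp)
    (by intro c u v; ext w; exact smul_comm _ _ _))

lemma tensorOpₗ_tmul (u v w : H) : tensorOpₗ (u ⊗ₜ[ℝ] v) w = inner ℝ u w • v := by
  simp [tensorOpₗ]

lemma inner_tensorOpₗ (t : H ⊗[ℝ] H) (w z : H) :
    inner ℝ (tensorOpₗ t w) z = inner ℝ t (w ⊗ₜ[ℝ] z) := by
  induction t with
  | zero => simp
  | tmul u v => simp [tensorOpₗ_tmul, inner_smul_left]
  | add s t hs ht => simp [inner_add_left, hs, ht]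

/-- Testing the operator against its own value `Tw` gives ‖Tw‖² = ⟪t, w ⊗ Tw⟫: the operator norm is
at most the Hilbert-Schmidt norm. -/
lemma norm_tensorOpₗ_le (t : H ⊗[ℝ] H) : ‖tensorOpₗ t‖ ≤ 1 * ‖t‖ := by
  refine ContinuousLinearMap.opNorm_le_bound _ (by positivity) fun w => ?_
  have h : ‖tensorOpₗ t w‖ * ‖tensorOpₗ t w‖ ≤ ‖t‖ * (‖w‖ * ‖tensorOpₗ t w‖) := by
    rw [← real_inner_self_eq_norm_mul_norm (tensorOpₗ t w), inner_tensorOpₗ]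
    refine (real_inner_le_norm t _).trans ?_
    rw [TensorProduct.norm_tmul]
  rcases (norm_nonneg (tensorOpₗ t w)).eq_or_lt' with h0 | h0
  · rw [h0]; positivity
  · rw [one_mul]
    exact le_of_mul_le_mul_right (by linarith) h0

/-- `tensorOpₗ` as a bounded operator for the Hilbert-Schmidt norm. -/
noncomputable def tensorOp : H ⊗[ℝ] H →L[ℝ] (H →L[ℝ] H) :=
  tensorOpₗ.mkContinuous 1 norm_tensorOpₗ_le

lemma tensorOp_tmul (u v w : H) : tensorOp (u ⊗ₜ[ℝ] v) w = inner ℝ u w • v :=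
  tensorOpₗ_tmul u v w

lemma isCompactOperator_tensorOp (t : H ⊗[ℝ] H) : IsCompactOperator (tensorOp t) := by
  induction t with
  | zero => simpa using isCompactOperator_zero
  | tmul u v =>
    have := (isCompactOperator_of_locallyCompactSpace_rng
      (ContinuousLinearMap.toSpanSingleton ℝ v)).comp_clm (innerSL ℝ u)
    refine Eq.mp (congrArg _ ?_) this
    ext w
    simp [tensorOp_tmul]
  | add s t hs ht => simpa using hs.add ht

/-- The action of `g ⊗ g` on tensors is conjugation by `g` on operators, so invariant tensors
correspond to operators commuting with the group. -/
lemma tensorOp_map (g : H ≃ₗᵢ[ℝ] H) (t : H ⊗[ℝ] H) (w : H) :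
    tensorOp (TensorProduct.congrIsometry g g t) (g w) = g (tensorOp t w) := by
  induction t with
  | zero => simp
  | tmul u v => simp [tensorOp_tmul]
  | add s t hs ht => simp only [map_add, add_apply, hs, ht]

/-- The orbit of `T w` is the image under `T` of the orbit of `w`, which is bounded. -/
lemma apply_mem_almostPeriodic_of_commute {G : Subgroup (H ≃ₗᵢ[ℝ] H)} {T : H →L[ℝ] H}
    (hT : IsCompactOperator T) (hG : ∀ g ∈ G, ∀ w, T (g w) = g (T w)) (w : H) :
    T w ∈ almostPeriodic G := by
  have hK : IsCompact (closure (T '' Metric.closedBall 0 ‖w‖)) :=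
    hT.isCompact_closure_image_closedBall _
  refine hK.totallyBounded.subset ?_
  rintro z ⟨g, hg, rfl⟩
  exact subset_closure ⟨g w, by simp, hG g hg w⟩

/-- A nonempty convex set of an inner product space has a Cauchy sequence whose differences with its
images under norm-preserving maps of the set tend to `0`. -/
lemma exists_cauchySeq_convex {E : Type*} [NormedAddCommGroup E] [InnerProductSpace ℝ E]
    {S : Set E} (hS : Convex ℝ S) (hne : S.Nonempty) :
    ∃ u : ℕ → E, (∀ n, u n ∈ S) ∧ CauchySeq u ∧
      ∀ g : E → E, (∀ x, ‖g x‖ = ‖x‖) → (∀ x ∈ S, g x ∈ S) →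
        Filter.Tendsto (fun n => g (u n) - u n) Filter.atTop (nhds 0) := by
  set m : ℝ := sInf ((fun x => ‖x‖ ^ 2) '' S) with hm
  have hbdd : BddBelow ((fun x : E => ‖x‖ ^ 2) '' S) := ⟨0, by rintro _ ⟨x, -, rfl⟩; positivity⟩
  have hle : ∀ x ∈ S, m ≤ ‖x‖ ^ 2 := fun x hx => csInf_le hbdd ⟨x, hx, rfl⟩
  have hex : ∀ n : ℕ, ∃ x ∈ S, ‖x‖ ^ 2 < m + 1 / ((n : ℝ) + 1) := fun n => by
    obtain ⟨_, ⟨x, hx, rfl⟩, h⟩ := exists_lt_of_csInf_lt (hne.image (fun x : E => ‖x‖ ^ 2))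
      (show m < m + 1 / ((n : ℝ) + 1) by linarith [Nat.one_div_pos_of_nat (α := ℝ) (n := n)])
    exact ⟨x, hx, h⟩
  choose u huS hu using hex
  -- Parallelogram law: the midpoint lies in `S`, so its squared norm is at least `m`, and
  -- near-minimizers are close together. Applied to `g (u n)` and `u n`, this also gives asymptotic
  -- invariance.
  have key : ∀ x ∈ S, ∀ y ∈ S, ∀ δ, ‖x‖ ^ 2 < m + δ → ‖y‖ ^ 2 < m + δ → ‖x - y‖ ^ 2 < 4 * δ := by
    intro x hx y hy δ h1 h2
    have hmid : (1 / 2 : ℝ) • x + (1 / 2 : ℝ) • y ∈ S :=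
      hS hx hy (by norm_num) (by norm_num) (by norm_num)
    have h3 := hle _ hmid
    rw [← smul_add, norm_smul, mul_pow] at h3
    have h4 := parallelogram_law_with_norm ℝ x y
    norm_num at h3
    nlinarith
  have hlim : Filter.Tendsto (fun n : ℕ => Real.sqrt (4 * (1 / ((n : ℝ) + 1))))
      Filter.atTop (nhds 0) := by
    have := (tendsto_one_div_add_atTop_nhds_zero_nat (𝕜 := ℝ)).const_mul 4
    have := (Real.continuous_sqrt.tendsto _).comp this
    simpa only [Function.comp_def, mul_zero, Real.sqrt_zero] using this
  refine ⟨u, huS, ?_, ?_⟩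
  · refine cauchySeq_of_le_tendsto_0 _ (fun n k N hn hk => ?_) hlim
    rw [dist_eq_norm]
    refine Real.le_sqrt_of_sq_le (key _ (huS _) _ (huS _) _ ?_ ?_).le
    · exact (hu n).trans_le (by gcongr)
    · exact (hu k).trans_le (by gcongr)
  · intro g hg hgS
    refine squeeze_zero_norm (fun n => ?_) hlim
    refine Real.le_sqrt_of_sq_le (key _ (hgS _ (huS _)) _ (huS _) _ ?_ (hu n)).le
    rw [hg]
    exact hu n

/-- The convex hull of the tensors `y ⊗ y` for `y` in the orbit of `x`. -/
def tensorHull (G : Subgroup (H ≃ₗᵢ[ℝ] H)) (x : H) : Set (H ⊗[ℝ] H) :=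
  convexHull ℝ ((fun y => y ⊗ₜ[ℝ] y) '' orbit G x)

lemma tensorHull_subset {G : Subgroup (H ≃ₗᵢ[ℝ] H)} {x : H} {P : Set (H ⊗[ℝ] H)}
    (hP : Convex ℝ P) (h : ∀ g ∈ G, g x ⊗ₜ[ℝ] g x ∈ P) : tensorHull G x ⊆ P := by
  refine convexHull_min ?_ hP
  rintro _ ⟨_, ⟨g, hg, rfl⟩, rfl⟩
  exact h g hg

lemma congrIsometry_mem_tensorHull {G : Subgroup (H ≃ₗᵢ[ℝ] H)} {x : H} {g : H ≃ₗᵢ[ℝ] H}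
    (hg : g ∈ G) {v : H ⊗[ℝ] H} (hv : v ∈ tensorHull G x) :
    TensorProduct.congrIsometry g g v ∈ tensorHull G x := by
  refine tensorHull_subset (P := (TensorProduct.congrIsometry g g).toLinearEquiv.toLinearMap ⁻¹'
    tensorHull G x) ((convex_convexHull ℝ _).linear_preimage _) (fun h hh => ?_) hv
  exact subset_convexHull ℝ _ ⟨g (h x), ⟨g * h, G.mul_mem hg hh, rfl⟩, rfl⟩

/-- The limit of a minimizing sequence in `tensorHull G x` is an invariant compact operator. -/
lemma exists_invariant_compact_limit [CompleteSpace H] (G : Subgroup (H ≃ₗᵢ[ℝ] H)) (x : H) :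
    ∃ (u : ℕ → H ⊗[ℝ] H) (T : H →L[ℝ] H), (∀ n, u n ∈ tensorHull G x) ∧ IsCompactOperator T ∧
      (∀ g ∈ G, ∀ w, T (g w) = g (T w)) ∧
      ∀ w, Filter.Tendsto (fun n => tensorOp (u n) w) Filter.atTop (nhds (T w)) := by
  obtain ⟨u, huS, hcau, hinv⟩ := exists_cauchySeq_convex
    (convex_convexHull ℝ _ : Convex ℝ (tensorHull G x))
    ⟨x ⊗ₜ x, subset_convexHull ℝ _ ⟨x, mem_orbit_self G x, rfl⟩⟩
  have hcau' : CauchySeq fun n => tensorOp (u n) :=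
    (tensorOp (H := H)).uniformContinuous.comp_cauchySeq hcau
  -- The algebraic tensor product need not be complete; the limit is taken among bounded operators.
  obtain ⟨T, hT⟩ := cauchySeq_tendsto_of_complete hcau'
  have hTapp : ∀ w, Filter.Tendsto (fun n => tensorOp (u n) w) Filter.atTop (nhds (T w)) :=
    fun w => ((ContinuousLinearMap.apply ℝ H w).continuous.tendsto T).comp hT
  have hTc : IsCompactOperator T := isCompactOperator_of_tendsto hT
    (.of_forall fun n => isCompactOperator_tensorOp _)
  refine ⟨u, T, huS, hTc, fun g hg w => ?_, hTapp⟩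
  have h1 := hinv (TensorProduct.congrIsometry g g) (fun x => LinearIsometryEquiv.norm_map _ x)
    fun v hv => congrIsometry_mem_tensorHull hg hv
  have h2 := ((tensorOp (H := H)).continuous.tendsto 0).comp h1
  rw [map_zero] at h2
  have h3 := ((ContinuousLinearMap.apply ℝ H (g w)).continuous.tendsto _).comp h2
  have h4 := ((g.continuous.tendsto _).comp (hTapp w)).sub h3
  rw [map_zero, sub_zero] at h4
  refine tendsto_nhds_unique (hTapp (g w)) (h4.congr fun n => ?_)
  change g (tensorOp (u n) w) -
    tensorOp (TensorProduct.congrIsometry g g (u n) - u n) (g w) = tensorOp (u n) (g w)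
  rw [map_sub, sub_apply, tensorOp_map]
  abel

lemma apply_mem_orthogonal_almostPeriodic {G : Subgroup (H ≃ₗᵢ[ℝ] H)} {g : H ≃ₗᵢ[ℝ] H}
    (hg : g ∈ G) {x : H} (hx : x ∈ (almostPeriodic G)ᗮ) : g x ∈ (almostPeriodic G)ᗮ := by
  rw [Submodule.mem_orthogonal] at hx ⊢
  intro y hy
  rw [← hx _ (apply_mem_almostPeriodic (G.inv_mem hg) hy), ← g.inner_map_map (g⁻¹ y) x]
  congr 1
  exact (g.apply_symm_apply y).symm

lemma norm_le_of_orthogonal_of_net [CompleteSpace H] {G : Subgroup (H ≃ₗᵢ[ℝ] H)} {x : H}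
    (hx : x ∈ (almostPeriodic G)ᗮ) {ε : ℝ} (hε : 0 ≤ ε) {t : Set H} (ht : t.Finite)
    (hxt : ∀ g ∈ G, ∃ c ∈ t, ‖g x - c‖ ≤ ε) : ‖x‖ ≤ ε := by
  by_contra! hlt
  obtain ⟨u, T, huS, hTc, hTG, hTapp⟩ := exists_invariant_compact_limit G x
  -- The values of `T` have totally bounded orbits and, as limits of combinations of orbit points of
  -- `x`, are orthogonal to all such vectors.
  have hT0 : ∀ w, T w = 0 := by
    intro w
    have h1 := apply_mem_almostPeriodic_of_commute hTc hTG w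
    have h2 : T w ∈ (almostPeriodic G)ᗮ := by
      refine (Submodule.isClosed_orthogonal _).mem_of_tendsto (hTapp w) (.of_forall fun n => ?_)
      refine tensorHull_subset (P := (((ContinuousLinearMap.apply ℝ H w).toLinearMap ∘ₗ tensorOpₗ) ⁻¹'
        ((almostPeriodic G)ᗮ : Set H)))
        ((Submodule.convex _).linear_preimage _) (fun g hg => ?_) (huS n)
      change tensorOp (g x ⊗ₜ[ℝ] g x) w ∈ (almostPeriodic G)ᗮ
      rw [tensorOp_tmul]
      exact Submodule.smul_mem _ _ (apply_mem_orthogonal_almostPeriodic hg hx)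
    exact Submodule.disjoint_def.1 (Submodule.orthogonal_disjoint _) _ h1 h2
  -- Lower bound for ⟪g x, c⟫ when ‖g x - c‖ ≤ ε, by expanding the square.
  set s : ℝ := (‖x‖ ^ 2 - ε ^ 2) / 2 with hs
  have hspos : 0 < s := by
    rw [hs]; nlinarith
  -- The sum is linear in the tensor, so the bound passes from the generators `g x ⊗ g x` to their
  -- convex hull.
  have hlow : ∀ n, s ^ 2 ≤ ∑ c ∈ ht.toFinset, inner ℝ (tensorOp (u n) c) c := by
    intro n
    refine tensorHull_subset (P := {v | s ^ 2 ≤ ∑ c ∈ ht.toFinset, inner ℝ (tensorOp v c) c})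
      ?_ (fun g hg => ?_) (huS n)
    · refine convex_halfSpace_ge (f := fun v => ∑ c ∈ ht.toFinset, inner ℝ (tensorOp v c) c)
        ⟨fun v w => ?_, fun r v => ?_⟩ _
      · simp [inner_add_left, Finset.sum_add_distrib]
      · simp [real_inner_smul_left, Finset.mul_sum]
    obtain ⟨c, hc, hgc⟩ := hxt g hg
    have h1 : s ≤ inner ℝ (g x) c := by
      have h2 := norm_sub_sq_real (g x) c
      rw [g.norm_map] at h2
      have h3 : ‖g x - c‖ ^ 2 ≤ ε ^ 2 := by gcongr
      rw [hs]
      nlinarith [sq_nonneg ‖c‖]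
    calc s ^ 2 ≤ inner ℝ (g x) c ^ 2 := by gcongr
      _ = inner ℝ (tensorOp (g x ⊗ₜ[ℝ] g x) c) c := by
        rw [tensorOp_tmul, real_inner_smul_left, sq]
      _ ≤ _ := by
        refine Finset.single_le_sum (f := fun c => inner ℝ (tensorOp (g x ⊗ₜ[ℝ] g x) c) c)
          (fun c _ => ?_) (ht.mem_toFinset.2 hc)
        simp only [tensorOp_tmul, real_inner_smul_left]
        exact mul_self_nonneg _
  have hlim : Filter.Tendsto (fun n => ∑ c ∈ ht.toFinset, inner ℝ (tensorOp (u n) c) c)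
      Filter.atTop (nhds (∑ c ∈ ht.toFinset, inner ℝ (T c) c)) :=
    tendsto_finsetSum _ fun c _ => (hTapp c).inner tendsto_const_nhds
  have := ge_of_tendsto' hlim hlow
  simp only [hT0, inner_zero_left, Finset.sum_const_zero] at this
  nlinarith

/-- A vector whose orbit has a finite `ε`-net is `ε`-close to a vector with totally bounded
orbit. -/
theorem exists_almostPeriodic_near [CompleteSpace H] {G : Subgroup (H ≃ₗᵢ[ℝ] H)} {x : H}
    {ε : ℝ} (hε : 0 ≤ ε) {t : Set H} (ht : t.Finite)
    (hxt : ∀ g ∈ G, ∃ c ∈ t, ‖g x - c‖ ≤ ε) : ∃ y ∈ almostPeriodic G, ‖x - y‖ ≤ ε := by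
  set M := almostPeriodic G with hM
  have : CompleteSpace M := (isClosed_almostPeriodic G).completeSpace_coe
  refine ⟨M.starProjection x, M.starProjection_apply_mem x, ?_⟩
  -- The projection to the orthogonal complement commutes with `G` and is a contraction, so it maps
  -- the net of the orbit of `x` to a net of the projected orbit.
  refine norm_le_of_orthogonal_of_net (G := G) (M.sub_starProjection_mem_orthogonal x) hε
    (ht.image fun c => c - M.starProjection c) ?_
  intro g hg
  obtain ⟨c, hc, hgc⟩ := hxt g hg
  refine ⟨_, ⟨c, hc, rfl⟩, ?_⟩
  have hproj : M.starProjection (g x) = g (M.starProjection x) := by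
    refine Submodule.eq_starProjection_of_mem_of_inner_eq_zero
      (apply_mem_almostPeriodic hg (M.starProjection_apply_mem x)) ?_
    intro w hw
    have h2 := M.starProjection_inner_eq_zero x _ (apply_mem_almostPeriodic (G.inv_mem hg) hw)
    rw [← map_sub, ← h2, ← g.inner_map_map (x - _)]
    congr 1
    exact (g.apply_symm_apply w).symm
  have : g (x - M.starProjection x) - (c - M.starProjection c) =
      Mᗮ.starProjection (g x - c) := by
    rw [Submodule.starProjection_orthogonal_val, map_sub, map_sub, hproj]
    abel
  rw [this]
  exact (Submodule.norm_starProjection_apply_le _ _).trans hgc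

end AlmostPeriodic

/-! ### Definable functions, invariance under automorphisms, and closed conditions -/

section Definability

/-- Renaming of the variables of a term. -/
def Term.rename {n m : ℕ} (f : Fin n → Fin m) : Term n → Term m
  | .var i => .var (f i)
  | .zero => .zero
  | .add s t => .add (s.rename f) (t.rename f)
  | .smul r t => .smul r (t.rename f)

/-- Renaming of the free variables of a formula. -/
def Formula.rename : {n : ℕ} → Formula n → {m : ℕ} → (Fin n → Fin m) → Formula m
  | _, .inner s t, _, f => .inner (s.rename f) (t.rename f)
  | _, .dist s t, _, f => .dist (s.rename f) (t.rename f)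
  | _, .dN t, _, f => .dN (t.rename f)
  | _, .conn c φ, _, f => .conn c fun i => (φ i).rename f
  | _, .sup k φ, m, f =>
      .sup k (φ.rename
        (Fin.snoc (α := fun _ => Fin (m + 1)) (fun i => (f i).castSucc) (Fin.last m)))
  | _, .inf k φ, m, f =>
      .inf k (φ.rename
        (Fin.snoc (α := fun _ => Fin (m + 1)) (fun i => (f i).castSucc) (Fin.last m)))

lemma snoc_comp_snoc_castSucc {X : Type*} {n m : ℕ} (f : Fin n → Fin m) (v : Fin m → X) (y : X) :
    (fun i => Fin.snoc (α := fun _ : Fin (m + 1) => X) v y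
      (Fin.snoc (α := fun _ => Fin (m + 1)) (fun i => (f i).castSucc) (Fin.last m) i)) =
      Fin.snoc (α := fun _ : Fin (n + 1) => X) (fun i => v (f i)) y := by
  funext i
  refine Fin.lastCases ?_ (fun j => ?_) i <;> simp

/-- The value of a variable or a parameter. -/
def assign {X : Type*} {A : Set X} {n : ℕ} (v : Fin n → X) : Fin n ⊕ A → X :=
  Sum.elim v Subtype.val

@[simp] lemma assign_inl {X : Type*} {A : Set X} {n : ℕ} (v : Fin n → X) (i : Fin n) :
    assign (A := A) v (Sum.inl i) = v i := rfl

@[simp] lemma assign_inr {X : Type*} {A : Set X} {n : ℕ} (v : Fin n → X) (a : A) :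
    assign v (Sum.inr a : Fin n ⊕ A) = a := rfl

lemma norm_snoc_le {X : Type*} [NormedAddCommGroup X] {n k : ℕ} {R : ℝ} {v : Fin n → X}
    (hv : ∀ i, ‖v i‖ ≤ R)
    (y : Metric.closedBall (0 : X) k) (i : Fin (n + 1)) :
    ‖Fin.snoc (α := fun _ : Fin (n + 1) => X) v y i‖ ≤ max R k := by
  refine Fin.lastCases ?_ (fun j => ?_) i
  · simpa using Or.inr (mem_closedBall_zero_iff.1 y.2)
  · simpa using Or.inl (hv j)

variable {H : Type u} [NormedAddCommGroup H] [InnerProductSpace ℝ H]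

lemma Term.eval_rename {n m : ℕ} (f : Fin n → Fin m) (v : Fin m → H) (t : Term n) :
    (t.rename f).eval v = t.eval (fun i => v (f i)) := by
  induction t with
  | var i => rfl
  | zero => rfl
  | add s t hs ht => simp only [Term.rename, Term.eval, hs, ht]
  | smul r t ht => simp only [Term.rename, Term.eval, ht]

lemma Formula.eval_rename (d : H → ℝ) {n : ℕ} (φ : Formula n) :
    ∀ {m : ℕ} (f : Fin n → Fin m) (v : Fin m → H),
      (φ.rename f).eval d v = φ.eval d (fun i => v (f i)) := by
  induction φ with
  | inner s t => intro m f v; simp only [Formula.rename, Formula.eval, Term.eval_rename]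
  | dist s t => intro m f v; simp only [Formula.rename, Formula.eval, Term.eval_rename]
  | dN t => intro m f v; simp only [Formula.rename, Formula.eval, Term.eval_rename]
  | conn c φ ih => intro m f v; simp only [Formula.rename, Formula.eval, ih]
  | sup k φ ih => intro m f v; simp only [Formula.rename, Formula.eval, ih, snoc_comp_snoc_castSucc]
  | inf k φ ih => intro m f v; simp only [Formula.rename, Formula.eval, ih, snoc_comp_snoc_castSucc]

lemma Term.exists_bound {n : ℕ} (t : Term n) (R : ℝ) :
    ∃ B, ∀ v : Fin n → H, (∀ i, ‖v i‖ ≤ R) → ‖t.eval v‖ ≤ B := by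
  induction t with
  | var i => exact ⟨R, fun v hv => hv i⟩
  | zero => exact ⟨0, fun v hv => by simp [Term.eval]⟩
  | add s t hs ht =>
    obtain ⟨B, hB⟩ := hs
    obtain ⟨B', hB'⟩ := ht
    exact ⟨B + B', fun v hv => (norm_add_le _ _).trans (add_le_add (hB v hv) (hB' v hv))⟩
  | smul r t ht =>
    obtain ⟨B, hB⟩ := ht
    refine ⟨|r| * B, fun v hv => ?_⟩
    rw [Term.eval, norm_smul, Real.norm_eq_abs]
    exact mul_le_mul_of_nonneg_left (hB v hv) (abs_nonneg _)

instance (k : ℕ) : Nonempty (Metric.closedBall (0 : H) k) := ⟨⟨0, by simp⟩⟩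

/-- Formulas are bounded on bounded sets. -/
lemma Formula.exists_bound {d : H → ℝ} (hd : ∀ x, d x ∈ Set.Icc (0 : ℝ) 1) {n : ℕ}
    (φ : Formula n) : ∀ R : ℝ, ∃ B, ∀ v : Fin n → H, (∀ i, ‖v i‖ ≤ R) → |φ.eval d v| ≤ B := by
  induction φ with
  | inner s t =>
    intro R
    obtain ⟨B, hB⟩ := s.exists_bound (H := H) R
    obtain ⟨B', hB'⟩ := t.exists_bound (H := H) R
    refine ⟨B * B', fun v hv => (abs_real_inner_le_norm _ _).trans ?_⟩
    exact mul_le_mul (hB v hv) (hB' v hv) (norm_nonneg _) ((norm_nonneg _).trans (hB v hv))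
  | dist s t =>
    intro R
    obtain ⟨B, hB⟩ := s.exists_bound (H := H) R
    obtain ⟨B', hB'⟩ := t.exists_bound (H := H) R
    refine ⟨B + B', fun v hv => ?_⟩
    rw [Formula.eval, abs_of_nonneg dist_nonneg, dist_eq_norm]
    exact (norm_sub_le _ _).trans (add_le_add (hB v hv) (hB' v hv))
  | dN t =>
    intro R
    refine ⟨1, fun v _ => ?_⟩
    rw [Formula.eval, abs_of_nonneg (hd _).1]
    exact (hd _).2
  | conn c φ ih =>
    intro R
    choose B hB using fun i => ih i R
    obtain ⟨M, hM⟩ := (isCompact_univ_pi fun i =>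
      isCompact_Icc (a := -B i) (b := B i)).exists_bound_of_continuousOn c.continuous.continuousOn
    exact ⟨M, fun v hv => hM _ fun i _ => abs_le.1 (hB i v hv)⟩
  | sup k φ ih =>
    intro R
    obtain ⟨B, hB⟩ := ih (max R k)
    refine ⟨B, fun v hv => ?_⟩
    have h := fun y : Metric.closedBall (0 : H) k => abs_le.1 (hB _ (norm_snoc_le hv y))
    have y0 : Metric.closedBall (0 : H) k := Classical.arbitrary _
    rw [Formula.eval]
    refine abs_le.2 ⟨(h y0).1.trans (le_ciSup (f := fun y : Metric.closedBall (0 : H) k =>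
      φ.eval d (Fin.snoc (α := fun _ : Fin (_ + 1) => H) v y)) ⟨B, ?_⟩ y0),
      ciSup_le fun y => (h y).2⟩
    rintro _ ⟨y, rfl⟩
    exact (h y).2
  | inf k φ ih =>
    intro R
    obtain ⟨B, hB⟩ := ih (max R k)
    refine ⟨B, fun v hv => ?_⟩
    have h := fun y : Metric.closedBall (0 : H) k => abs_le.1 (hB _ (norm_snoc_le hv y))
    have y0 : Metric.closedBall (0 : H) k := Classical.arbitrary _
    rw [Formula.eval]
    refine abs_le.2 ⟨le_ciInf fun y => (h y).1,
      (ciInf_le (f := fun y : Metric.closedBall (0 : H) k =>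
      φ.eval d (Fin.snoc (α := fun _ : Fin (_ + 1) => H) v y)) ⟨-B, ?_⟩ y0).trans (h y0).2⟩
    rintro _ ⟨y, rfl⟩
    exact (h y).1

lemma Term.eval_map (σ : H ≃ₗᵢ[ℝ] H) {n : ℕ} (v : Fin n → H) (t : Term n) :
    t.eval (fun i => σ (v i)) = σ (t.eval v) := by
  induction t with
  | var i => rfl
  | zero => simp [Term.eval]
  | add s t hs ht => simp [Term.eval, hs, ht]
  | smul r t ht => simp [Term.eval, ht]

/-- The permutation of a ball induced by a linear isometry. -/
def ballEquiv (σ : H ≃ₗᵢ[ℝ] H) (k : ℕ) :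
    Metric.closedBall (0 : H) k ≃ Metric.closedBall (0 : H) k :=
  σ.toLinearEquiv.toEquiv.subtypeEquiv fun x => by simp

lemma snoc_map {n k : ℕ} (σ : H ≃ₗᵢ[ℝ] H) (v : Fin n → H) (y : Metric.closedBall (0 : H) k) :
    Fin.snoc (α := fun _ : Fin (n + 1) => H) (fun i => σ (v i)) (ballEquiv σ k y) =
      fun i => σ (Fin.snoc (α := fun _ : Fin (n + 1) => H) v y i) := by
  funext i
  refine Fin.lastCases ?_ (fun j => ?_) i
  · simp [ballEquiv]
  · simp

/-- Automorphisms preserve the values of formulas. -/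
lemma Formula.eval_map {d : H → ℝ} {σ : H ≃ₗᵢ[ℝ] H} (hσ : ∀ x, d (σ x) = d x) {n : ℕ}
    (φ : Formula n) : ∀ v : Fin n → H, φ.eval d (fun i => σ (v i)) = φ.eval d v := by
  induction φ with
  | inner s t => intro v; simp [Formula.eval, Term.eval_map]
  | dist s t => intro v; simp [Formula.eval, Term.eval_map]
  | dN t => intro v; simp [Formula.eval, Term.eval_map, hσ]
  | conn c φ ih => intro v; simp only [Formula.eval, ih]
  | sup k φ ih =>
    intro v
    simp only [Formula.eval]
    refine ((ballEquiv σ k).iSup_congr fun y => ?_).symm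
    rw [snoc_map, ih]
  | inf k φ ih =>
    intro v
    simp only [Formula.eval]
    refine ((ballEquiv σ k).iInf_congr fun y => ?_).symm
    rw [snoc_map, ih]

/-- The automorphisms of `(H, d)` that fix `A` pointwise. -/
def autGroup (d : H → ℝ) (A : Set H) : Subgroup (H ≃ₗᵢ[ℝ] H) where
  carrier := {σ | (∀ x, d (σ x) = d x) ∧ ∀ x ∈ A, σ x = x}
  one_mem' := ⟨fun _ => rfl, fun _ _ => rfl⟩
  mul_mem' := fun {σ τ} hσ hτ => ⟨fun x => (hσ.1 (τ x)).trans (hτ.1 x), fun x hx =>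
    (congrArg σ (hτ.2 x hx)).trans (hσ.2 x hx)⟩
  inv_mem' := fun {σ} hσ => ⟨fun x => by
      have := hσ.1 (σ.symm x)
      rw [σ.apply_symm_apply] at this
      exact this.symm,
    fun x hx => by
      change σ.symm x = x
      rw [σ.symm_apply_eq, hσ.2 x hx]⟩

lemma autGroup_anti (d : H → ℝ) {A B : Set H} (h : A ⊆ B) : autGroup d B ≤ autGroup d A :=
  fun _ hσ => ⟨hσ.1, fun x hx => hσ.2 x (h hx)⟩

lemma autGroup_eq_of_dense (d : H → ℝ) {A D : Set H} (h : D ⊆ A) (h' : A ⊆ closure D) :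
    autGroup d A = autGroup d D := by
  refine le_antisymm (autGroup_anti d h) fun σ hσ => ⟨hσ.1, fun x hx => ?_⟩
  have : closure D ⊆ {x | σ x = x} :=
    closure_minimal hσ.2 (isClosed_eq σ.continuous continuous_id)
  exact this (h' hx)

/-- `F` is the function defined by a formula with parameters in `A`. -/
def IsDef (d : H → ℝ) (A : Set H) {n : ℕ} (F : (Fin n → H) → ℝ) : Prop :=
  ∃ (m : ℕ) (φ : Formula m) (t : Fin m → Fin n ⊕ A), ∀ v, F v = φ.eval d fun j => assign v (t j)

variable {d : H → ℝ} {A B : Set H} {n : ℕ} {F G : (Fin n → H) → ℝ}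

lemma ParamFormula.isDef (χ : ParamFormula A n) : IsDef d A (χ.eval d) := by
  refine ⟨_, χ.formula, Fin.addCases Sum.inl fun j => Sum.inr ⟨χ.param j, χ.param_mem j⟩,
    fun v => ?_⟩
  unfold ParamFormula.eval
  congr 1
  funext i
  refine Fin.addCases (fun j => ?_) (fun j => ?_) i <;> simp

lemma IsDef.exists_paramFormula (hF : IsDef d A F) :
    ∃ χ : ParamFormula A n, ∀ v, χ.eval d v = F v := by
  obtain ⟨m, φ, t, hφ⟩ := hF
  -- A slot of `t` that holds a variable leaves its parameter position unused; it is padded with an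
  -- arbitrary element of `A`, or the arity is `0` if `A` is empty.
  rcases isEmpty_or_nonempty A with hA | ⟨⟨a⟩⟩
  · have ht : ∀ j, ∃ i, t j = Sum.inl i := fun j => by
      rcases h : t j with i | a
      · exact ⟨i, rfl⟩
      · exact isEmptyElim a
    choose f hf using ht
    refine ⟨⟨0, φ.rename fun j => Fin.castAdd 0 (f j), Fin.elim0, fun j => j.elim0⟩, fun v => ?_⟩
    rw [ParamFormula.eval, Formula.eval_rename, hφ]
    simp [hf]
  · refine ⟨⟨m, φ.rename fun j => Sum.elim (Fin.castAdd m) (fun _ => Fin.natAdd n j) (t j),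
      fun j => Sum.elim (fun _ => (a : H)) Subtype.val (t j), fun j => ?_⟩, fun v => ?_⟩
    · rcases t j with i | p <;> simp
    · rw [ParamFormula.eval, Formula.eval_rename, hφ]
      congr 1
      funext j
      rcases h : t j with i | p <;> simp [h]

lemma IsDef.mono (hAB : A ⊆ B) (hF : IsDef d A F) : IsDef d B F := by
  obtain ⟨m, φ, t, hφ⟩ := hF
  refine ⟨m, φ, fun j => Sum.map id (Set.inclusion hAB) (t j), fun v => ?_⟩
  rw [hφ]
  congr 1
  funext j
  rcases h : t j with i | p <;> simp [h]

lemma IsDef.subst {k : ℕ} (hF : IsDef d A F) (f : Fin n → Fin k ⊕ A) :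
    IsDef d A fun v : Fin k → H => F fun i => assign v (f i) := by
  obtain ⟨m, φ, t, hφ⟩ := hF
  refine ⟨m, φ, fun j => Sum.elim f Sum.inr (t j), fun v => ?_⟩
  simp only [hφ]
  congr 1
  funext j
  rcases t j with i | p <;> rfl

lemma isDef_dist (p q : Fin n ⊕ A) : IsDef d A fun v => dist (assign v p) (assign v q) :=
  ⟨2, .dist (.var 0) (.var 1), ![p, q], fun v => by simp [Formula.eval, Term.eval]⟩

lemma isDef_inner (p q : Fin n ⊕ A) : IsDef d A fun v => inner ℝ (assign v p) (assign v q) :=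
  ⟨2, .inner (.var 0) (.var 1), ![p, q], fun v => by simp [Formula.eval, Term.eval]⟩

lemma IsDef.comp₂ (hF : IsDef d A F) (hG : IsDef d A G) {c : ℝ × ℝ → ℝ} (hc : Continuous c) :
    IsDef d A fun v => c (F v, G v) := by
  obtain ⟨m, φ, t, hφ⟩ := hF
  obtain ⟨k, ψ, s, hψ⟩ := hG
  refine ⟨m + k, .conn ⟨fun w : Fin 2 → ℝ => c (w 0, w 1), by fun_prop⟩
    ![φ.rename (Fin.castAdd k), ψ.rename (Fin.natAdd m)], Fin.append t s, fun v => ?_⟩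
  simp [Formula.eval, Formula.eval_rename, hφ, hψ]

lemma IsDef.comp₁ (hF : IsDef d A F) {c : ℝ → ℝ} (hc : Continuous c) :
    IsDef d A fun v => c (F v) :=
  hF.comp₂ hF (c := fun p => c p.1) (by fun_prop)

lemma isDef_const (r : ℝ) : IsDef d A fun _ : Fin n → H => r :=
  ⟨0, .conn (k := 0) ⟨fun _ => r, continuous_const⟩ Fin.elim0, Fin.elim0, fun _ => rfl⟩

lemma IsDef.map (hF : IsDef d A F) {σ : H ≃ₗᵢ[ℝ] H} (hσ : σ ∈ autGroup d A) (v : Fin n → H) :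
    F (fun i => σ (v i)) = F v := by
  obtain ⟨m, φ, t, hφ⟩ := hF
  rw [hφ, hφ, ← φ.eval_map hσ.1 fun j => assign v (t j)]
  congr 1
  funext j
  rcases t j with i | p
  · rfl
  · exact (hσ.2 p p.2).symm

lemma IsDef.exists_bound (hd : ∀ x, d x ∈ Set.Icc (0 : ℝ) 1) (hF : IsDef d A F) (R : ℝ) :
    ∃ M, ∀ v : Fin n → H, (∀ i, ‖v i‖ ≤ R) → |F v| ≤ M := by
  obtain ⟨m, φ, t, hφ⟩ := hF
  obtain ⟨M, hM⟩ := φ.exists_bound hd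
    (max R (∑ j, Sum.elim (fun _ => 0) (fun p : A => ‖(p : H)‖) (t j)))
  refine ⟨M, fun v hv => ?_⟩
  rw [hφ]
  refine hM _ fun j => ?_
  have h := Finset.single_le_sum
    (f := fun j => Sum.elim (fun _ => 0) (fun p : A => ‖(p : H)‖) (t j))
    (fun i _ => by rcases t i with i | p <;> simp) (Finset.mem_univ j)
  rcases h' : t j with i | p
  · exact (hv i).trans (le_max_left _ _)
  · simp only [h', Sum.elim_inr] at h
    exact h.trans (le_max_right _ _)

lemma IsDef.exists_quantified {F : (Fin (n + 1) → H) → ℝ} (hF : IsDef d A F) :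
    ∃ (m : ℕ) (φ : Formula (m + 1)) (t : Fin m → Fin n ⊕ A), ∀ (v : Fin n → H) (y : H),
      F (Fin.snoc (α := fun _ => H) v y) =
        φ.eval d (Fin.snoc (α := fun _ => H) (fun j => assign v (t j)) y) := by
  obtain ⟨χ, hχ⟩ := hF.exists_paramFormula
  refine ⟨n + χ.arity, χ.formula.rename (Fin.addCases
    (Fin.snoc (α := fun _ => Fin (n + χ.arity + 1)) (fun i => (Fin.castAdd _ i).castSucc)
      (Fin.last _))
    fun j => (Fin.natAdd n j).castSucc),
    Fin.addCases Sum.inl fun j => Sum.inr ⟨χ.param j, χ.param_mem j⟩, fun v y => ?_⟩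
  rw [← hχ, ParamFormula.eval, Formula.eval_rename]
  congr 1
  funext i
  refine Fin.addCases (fun j => ?_) (fun j => ?_) i
  · refine Fin.lastCases ?_ (fun j => ?_) j <;> simp
  · simp only [Fin.append_right, Fin.addCases_right, Fin.snoc_castSucc, assign_inr]

lemma IsDef.iSup {F : (Fin (n + 1) → H) → ℝ} (hF : IsDef d A F) (k : ℕ) :
    IsDef d A fun v : Fin n → H =>
      ⨆ y : Metric.closedBall (0 : H) k, F (Fin.snoc (α := fun _ => H) v y) := by
  obtain ⟨m, φ, t, h⟩ := hF.exists_quantified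
  exact ⟨m, .sup k φ, t, fun v => by simp only [Formula.eval, h]⟩

lemma IsDef.iInf {F : (Fin (n + 1) → H) → ℝ} (hF : IsDef d A F) (k : ℕ) :
    IsDef d A fun v : Fin n → H =>
      ⨅ y : Metric.closedBall (0 : H) k, F (Fin.snoc (α := fun _ => H) v y) := by
  obtain ⟨m, φ, t, h⟩ := hF.exists_quantified
  exact ⟨m, .inf k φ, t, fun v => by simp only [Formula.eval, h]⟩

/-- Boundedness on the ball is what makes real `⨆` and `⨅` genuine bounds rather than default
values. -/
lemma IsDef.exists_abs_snoc_le (hd : ∀ x, d x ∈ Set.Icc (0 : ℝ) 1) {F : (Fin (n + 1) → H) → ℝ}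
    (hF : IsDef d A F) (k : ℕ) (v : Fin n → H) :
    ∃ M, ∀ y : Metric.closedBall (0 : H) k, |F (Fin.snoc (α := fun _ => H) v y)| ≤ M := by
  obtain ⟨M, hM⟩ := hF.exists_bound hd (max (∑ i, ‖v i‖) k)
  exact ⟨M, fun y => hM _ (norm_snoc_le (fun i =>
    Finset.single_le_sum (f := fun i => ‖v i‖) (fun _ _ => norm_nonneg _) (Finset.mem_univ i)) y)⟩

/-- Parameters from a finite tuple can be turned into variables. -/
lemma IsDef.exists_snoc {b : Fin n → H} {F : (Fin 1 → H) → ℝ}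
    (hF : IsDef d (Set.range b ∪ A) F) : ∃ F' : (Fin (n + 1) → H) → ℝ, IsDef d A F' ∧
      ∀ z, F' (Fin.snoc (α := fun _ => H) b z) = F ![z] := by
  classical
  obtain ⟨m, φ, t, hφ⟩ := hF
  have key : ∀ p : Fin 1 ⊕ ↥(Set.range b ∪ A), ∃ q : Fin (n + 1) ⊕ A, ∀ z : H,
      assign (Fin.snoc (α := fun _ => H) b z) q = assign ![z] p := by
    rintro (i | ⟨p, ⟨i, hi⟩ | hp⟩)
    · exact ⟨Sum.inl (Fin.last n), fun z => by simp⟩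
    · exact ⟨Sum.inl i.castSucc, fun z => by simp [hi]⟩
    · exact ⟨Sum.inr ⟨p, hp⟩, fun z => rfl⟩
  choose f hf using key
  refine ⟨_, ⟨m, φ, fun j => f (t j), fun v => rfl⟩, fun z => ?_⟩
  simp only [hφ, hf]

/-- `P` is a closed condition with parameters in `A`. -/
def IsCond (d : H → ℝ) (A : Set H) {n : ℕ} (P : (Fin n → H) → Prop) : Prop :=
  ∃ F : (Fin n → H) → ℝ, IsDef d A F ∧ ∀ v, F v ≤ 0 ↔ P v

lemma IsDef.isCond_le (hF : IsDef d A F) (r : ℝ) : IsCond d A fun v => F v ≤ r :=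
  ⟨_, hF.comp₁ (c := fun x => x - r) (by fun_prop), fun v => by simp⟩

lemma IsDef.isCond_ge (hF : IsDef d A F) (r : ℝ) : IsCond d A fun v => r ≤ F v :=
  ⟨_, hF.comp₁ (c := fun x => r - x) (by fun_prop), fun v => by simp⟩

lemma IsCond.or {P Q : (Fin n → H) → Prop} (hP : IsCond d A P) (hQ : IsCond d A Q) :
    IsCond d A fun v => P v ∨ Q v := by
  obtain ⟨F, hF, hFP⟩ := hP
  obtain ⟨G, hG, hGQ⟩ := hQ
  exact ⟨_, hF.comp₂ hG (c := fun p => min p.1 p.2) (by fun_prop), fun v => by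
    simp [hFP, hGQ]⟩

lemma IsCond.and {P Q : (Fin n → H) → Prop} (hP : IsCond d A P) (hQ : IsCond d A Q) :
    IsCond d A fun v => P v ∧ Q v := by
  obtain ⟨F, hF, hFP⟩ := hP
  obtain ⟨G, hG, hGQ⟩ := hQ
  exact ⟨_, hF.comp₂ hG (c := fun p => max p.1 p.2) (by fun_prop), fun v => by
    simp [hFP, hGQ]⟩

lemma IsCond.exists_finite {ι : Type*} [Finite ι] {P : ι → (Fin n → H) → Prop}
    (hP : ∀ i, IsCond d A (P i)) : IsCond d A fun v => ∃ i, P i v := by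
  have key : ∀ s : Set ι, s.Finite → IsCond d A fun v => ∃ i ∈ s, P i v := fun s hs => by
    induction s, hs using Set.Finite.induction_on with
    | empty => exact ⟨_, isDef_const 1, fun v => by simp⟩
    | insert _ _ ih =>
      simp only [Set.exists_mem_insert]
      exact (hP _).or ih
  simpa using key Set.univ Set.finite_univ

lemma IsCond.forall_ball (hd : ∀ x, d x ∈ Set.Icc (0 : ℝ) 1) {P : (Fin (n + 1) → H) → Prop}
    (hP : IsCond d A P) (k : ℕ) :
    IsCond d A fun v => ∀ y, ‖y‖ ≤ k → P (Fin.snoc (α := fun _ => H) v y) := by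
  obtain ⟨F, hF, hFP⟩ := hP
  refine ⟨_, hF.iSup k, fun v => ?_⟩
  obtain ⟨M, hM⟩ := hF.exists_abs_snoc_le hd k v
  rw [ciSup_le_iff ⟨M, by rintro _ ⟨y, rfl⟩; exact (abs_le.1 (hM y)).2⟩]
  simp [hFP]

lemma IsCond.forall_ball_append (hd : ∀ x, d x ∈ Set.Icc (0 : ℝ) 1) (k : ℕ) {m : ℕ} :
    ∀ {P : (Fin (n + m) → H) → Prop}, IsCond d A P →
      IsCond d A fun v => ∀ w : Fin m → H, (∀ i, ‖w i‖ ≤ k) → P (Fin.append v w) := by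
  induction m with
  | zero =>
    intro P hP
    refine Eq.mp (congrArg _ ?_) hP
    funext v
    refine propext ⟨fun h w _ => ?_, fun h => ?_⟩
    · rwa [Subsingleton.elim w Fin.elim0, Fin.append_elim0]
    · have := h Fin.elim0 fun i => i.elim0
      rwa [Fin.append_elim0] at this
  | succ m ih =>
    intro P hP
    refine Eq.mp (congrArg _ ?_) (ih (hP.forall_ball hd k))
    funext v
    refine propext ⟨fun h w hw => ?_, fun h w hw y hy => ?_⟩
    · have := h (Fin.init w) (fun i => hw _) (w (Fin.last m)) (hw _)
      rwa [← Fin.append_snoc, Fin.snoc_init_self] at this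
    · rw [← Fin.append_snoc]
      refine h _ fun i => ?_
      refine Fin.lastCases ?_ (fun j => ?_) i
      · simpa using hy
      · simpa using hw j

end Definability

/-! ### Types as orbits, algebraic closure, and isolation of compact orbits -/

section Saturation

lemma mk_union_finite_lt {X : Type u} {κ : Cardinal.{u}} {A : Set X}
    (hκ : Cardinal.aleph0 < κ) (hA : Cardinal.mk A < κ) {T : Set X}
    (hT : T.Finite) : Cardinal.mk ↥(A ∪ T) < κ :=
  (Cardinal.mk_union_le A T).trans_lt
    (Cardinal.add_lt_of_lt hκ.le hA ((Cardinal.lt_aleph0_iff_set_finite.2 hT).trans hκ))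

lemma eq_vec_one {X : Type*} (b : Fin 1 → X) : b = ![b 0] := by
  funext i
  rw [Subsingleton.elim i 0]
  rfl

variable {H : Type u} [NormedAddCommGroup H] [InnerProductSpace ℝ H] {d : H → ℝ}
  {κ : Cardinal.{u}} {A : Set H} {n : ℕ}

lemma IsSaturated.exists_forall_le (hd : IsSaturated d κ) (hA : Cardinal.mk A < κ) (r : ℕ)
    {𝓕 : Set ((Fin n → H) → ℝ)} (h𝓕 : ∀ F ∈ 𝓕, IsDef d A F)
    (hfin : ∀ 𝓕₀ ⊆ 𝓕, 𝓕₀.Finite → ∃ b : Fin n → H, (∀ i, ‖b i‖ ≤ r) ∧ ∀ F ∈ 𝓕₀, F b ≤ 0) :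
    ∃ b : Fin n → H, (∀ i, ‖b i‖ ≤ r) ∧ ∀ F ∈ 𝓕, F b ≤ 0 := by
  obtain ⟨b, hbr, hb⟩ := hd A hA n r {χ | ∃ F ∈ 𝓕, ∀ v, χ.eval d v = max 0 (F v)} (by
    intro Γ₀ hΓ₀ hfinΓ
    choose! f hf hfe using hΓ₀
    obtain ⟨b, hbr, hb⟩ := hfin (f '' Γ₀) (by rintro _ ⟨χ, hχ, rfl⟩; exact hf hχ) (hfinΓ.image f)
    refine ⟨b, hbr, fun χ hχ => ?_⟩
    rw [Realizes, hfe hχ, max_eq_left (hb _ ⟨χ, hχ, rfl⟩)])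
  refine ⟨b, hbr, fun F hF => ?_⟩
  obtain ⟨χ, hχ⟩ := ((h𝓕 F hF).comp₁ (c := fun x => max 0 x) (by fun_prop)).exists_paramFormula
  have h : χ.eval d b = 0 := hb χ ⟨F, hF, hχ⟩
  rw [hχ] at h
  exact (le_max_right _ _).trans h.le

lemma tpN_eq_iff {x y : Fin n → H} :
    tpN d A y = tpN d A x ↔ ∀ F, IsDef d A F → F y = F x := by
  constructor
  · intro h F hF
    obtain ⟨χ, hχ⟩ := (hF.comp₁ (c := fun r => r - F x) (by fun_prop)).exists_paramFormula
    have hx : χ ∈ tpN d A x := by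
      change χ.eval d x = 0
      rw [hχ, sub_self]
    rw [← h] at hx
    have hy : χ.eval d y = 0 := hx
    rw [hχ] at hy
    exact sub_eq_zero.1 hy
  · intro h
    ext χ
    change χ.eval d y = 0 ↔ χ.eval d x = 0
    rw [h _ χ.isDef]

lemma map_singleton (σ : H ≃ₗᵢ[ℝ] H) (x : H) : (fun i => σ (![x] i)) = ![σ x] := by
  funext i
  simp

lemma IsDef.eq_of_mem_orbit {F : (Fin 1 → H) → ℝ} (hF : IsDef d A F) {x y : H}
    (hy : y ∈ orbit (autGroup d A) x) : F ![y] = F ![x] := by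
  obtain ⟨σ, hσ, rfl⟩ := hy
  rw [← hF.map hσ ![x], map_singleton]

/-- Equal types make the map sending `x` to `y` and fixing `A` elementary, so it extends to an
automorphism. If `x ∈ A`, the distance to `x` forces `y = x`. -/
lemma IsStronglyHomogeneous.mem_orbit (hd : IsStronglyHomogeneous d κ) (hκ : Cardinal.aleph0 < κ)
    (hA : Cardinal.mk A < κ) {x y : H} (h : ∀ F : (Fin 1 → H) → ℝ, IsDef d A F → F ![y] = F ![x]) :
    y ∈ orbit (autGroup d A) x := by
  classical
  have hcard : Cardinal.mk ↥(insert x A) < κ :=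
    Cardinal.mk_insert_le.trans_lt
      (Cardinal.add_lt_of_lt hκ.le hA (Cardinal.one_lt_aleph0.trans hκ))
  have hxA : x ∈ A → y = x := fun hx => by
    have := h _ (isDef_dist (Sum.inl 0) (Sum.inr ⟨x, hx⟩))
    simpa using this
  obtain ⟨σ, hσ, hσA⟩ := hd (insert x A) hcard (Function.update id x y) (by
    intro m φ v hv
    have key : ∀ j, ∃ q : Fin 1 ⊕ A, assign ![y] q = Function.update id x y (v j) ∧
        assign ![x] q = v j := fun j => by
      by_cases hj : v j = x
      · exact ⟨Sum.inl 0, by simp [hj], by simp [hj]⟩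
      · exact ⟨Sum.inr ⟨v j, (hv j).resolve_left hj⟩, by simp [hj], rfl⟩
    choose t ht ht' using key
    have := h _ ⟨m, φ, t, fun v => rfl⟩
    simpa only [ht, ht'] using this)
  refine ⟨σ, ⟨hσ, fun a ha => ?_⟩, by rw [hσA x (Set.mem_insert _ _)]; simp⟩
  rw [hσA a (Set.mem_insert_of_mem _ ha)]
  by_cases hax : a = x
  · subst hax
    simpa using hxA ha
  · simp [hax]

lemma setOf_tpN_eq (hd : IsStronglyHomogeneous d κ) (hκ : Cardinal.aleph0 < κ)
    (hA : IsSmall κ A) (x : H) :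
    {y : H | tpN d A ![y] = tpN d A ![x]} = orbit (autGroup d A) x := by
  obtain ⟨D, hDA, hAD, hD⟩ := hA
  ext y
  rw [Set.mem_ofPred_eq, tpN_eq_iff]
  constructor
  · intro h
    rw [autGroup_eq_of_dense d hDA hAD]
    exact hd.mem_orbit hκ hD fun F hF => h F (hF.mono hDA)
  · exact fun hy F hF => hF.eq_of_mem_orbit hy

/-- For `y` in the closure, saturation over `A ∪ {y}` realizes the type of `x` at distance `0` from
`y`. -/
lemma isClosed_orbit (hκ : Cardinal.aleph0 < κ) (hs : IsSaturated d κ)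
    (hh : IsStronglyHomogeneous d κ) (hA : Cardinal.mk A < κ) (x : H) :
    IsClosed (orbit (autGroup d A) x) := by
  refine isClosed_of_closure_subset fun y hy => ?_
  obtain ⟨r, hr⟩ := exists_nat_ge ‖x‖
  let 𝓕 : Set ((Fin 1 → H) → ℝ) := {F | ∃ G, IsDef d A G ∧ F = fun v => |G v - G ![x]|} ∪
    {F | ∃ δ > 0, F = fun v => dist (v 0) y - δ}
  obtain ⟨b, -, hb⟩ := hs.exists_forall_le (mk_union_finite_lt hκ hA (Set.finite_singleton y)) r
    (𝓕 := 𝓕) (by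
      rintro F (⟨G, hG, rfl⟩ | ⟨δ, hδ, rfl⟩)
      · exact (hG.mono Set.subset_union_left).comp₁ (c := fun s => |s - G ![x]|) (by fun_prop)
      · exact (isDef_dist (Sum.inl 0) (Sum.inr ⟨y, Or.inr rfl⟩)).comp₁ (c := fun s => s - δ)
          (by fun_prop)) (by
      intro 𝓕₀ h𝓕 hfin
      have hne : (nhdsWithin y (orbit (autGroup d A) x)).NeBot :=
        mem_closure_iff_nhdsWithin_neBot.1 hy
      have hev : ∀ᶠ z in nhdsWithin y (orbit (autGroup d A) x), ∀ F ∈ 𝓕₀, F ![z] ≤ 0 := by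
        refine (Filter.eventually_all_finite hfin).2 fun F hF => ?_
        rcases h𝓕 hF with ⟨G, hG, rfl⟩ | ⟨δ, hδ, rfl⟩
        · filter_upwards [self_mem_nhdsWithin] with z hz
          rw [hG.eq_of_mem_orbit hz]
          simp
        · filter_upwards [nhdsWithin_le_nhds (Metric.ball_mem_nhds y hδ)] with z hz
          simpa using (Metric.mem_ball.1 hz).le
      obtain ⟨z, hz, ⟨g, hg, rfl⟩⟩ := (hev.and self_mem_nhdsWithin).exists
      exact ⟨![g x], fun i => by simpa using hr, hz⟩)
  rw [eq_vec_one b] at hb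
  have hby : b 0 = y := by
    refine dist_le_zero.1 (le_of_forall_pos_le_add fun δ hδ => ?_)
    have := hb _ (Or.inr ⟨δ, hδ, rfl⟩)
    simp only [Matrix.cons_val_zero] at this
    linarith
  rw [hby] at hb
  refine hh.mem_orbit hκ hA fun G hG => ?_
  have := hb _ (Or.inl ⟨G, hG, rfl⟩)
  exact sub_eq_zero.1 (abs_nonpos_iff.1 this)

/-- The algebraic closure of a small set consists of the vectors whose orbit under the
automorphisms over that set is totally bounded. -/
lemma aclN_eq_almostPeriodic [CompleteSpace H] (hκ : Cardinal.aleph0 < κ) (hs : IsSaturated d κ)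
    (hh : IsStronglyHomogeneous d κ) (hA : IsSmall κ A) :
    aclN d A = almostPeriodic (autGroup d A) := by
  ext x
  change IsCompact _ ↔ TotallyBounded _
  rw [setOf_tpN_eq hh hκ hA]
  refine ⟨fun h => h.totallyBounded, fun h => h.isCompact_of_isClosed ?_⟩
  obtain ⟨D, hDA, hAD, hD⟩ := hA
  rw [autGroup_eq_of_dense d hDA hAD]
  exact isClosed_orbit hκ hs hh hD x

/-- A compact orbit can be isolated, up to `η`, by a single formula. -/
lemma exists_isDef_near_orbit (hκ : Cardinal.aleph0 < κ) (hs : IsSaturated d κ)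
    (hh : IsStronglyHomogeneous d κ) (hA : Cardinal.mk A < κ) {x : H}
    (hx : x ∈ almostPeriodic (autGroup d A)) (r : ℕ) {η : ℝ} (hη : 0 < η) :
    ∃ φ : (Fin 1 → H) → ℝ, IsDef d A φ ∧ φ ![x] ≤ 0 ∧
      ∀ z, ‖z‖ ≤ r → φ ![z] ≤ 1 → ∃ y ∈ orbit (autGroup d A) x, ‖z - y‖ < η := by
  obtain ⟨T, hTo, hT, hcov⟩ := Metric.finite_approx_of_totallyBounded (mem_almostPeriodic.1 hx) η hη
  -- Having the type of `x` over `A` and being `η`-far from the finite net `T` of its orbit are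
  -- contradictory; saturation over `A ∪ T` extracts a finite contradictory part.
  let 𝓕 : Set ((Fin 1 → H) → ℝ) :=
    {F | ∃ G, IsDef d A G ∧ ∃ δ > 0, F = fun v => |G v - G ![x]| - δ} ∪
    {F | ∃ c ∈ T, F = fun v => η - dist (v 0) c}
  have hnot : ¬ ∃ b : Fin 1 → H, (∀ i, ‖b i‖ ≤ r) ∧ ∀ F ∈ 𝓕, F b ≤ 0 := by
    rintro ⟨b, -, hb⟩
    rw [eq_vec_one b] at hb
    have ho : b 0 ∈ orbit (autGroup d A) x := by
      refine hh.mem_orbit hκ hA fun G hG => ?_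
      refine sub_eq_zero.1 (abs_nonpos_iff.1 (le_of_forall_pos_le_add fun δ hδ => ?_))
      have := hb _ (Or.inl ⟨G, hG, δ, hδ, rfl⟩)
      linarith
    have := hcov ho
    simp only [Set.mem_iUnion, Metric.mem_ball, exists_prop] at this
    obtain ⟨c, hc, hbc⟩ := this
    have := hb _ (Or.inr ⟨c, hc, rfl⟩)
    simp only [Matrix.cons_val_zero] at this
    linarith
  have hfin : ∃ 𝓕₀ ⊆ 𝓕, 𝓕₀.Finite ∧ ∀ z : H, ‖z‖ ≤ r → ∃ F ∈ 𝓕₀, 0 < F ![z] := by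
    by_contra! hcon
    refine hnot (hs.exists_forall_le (mk_union_finite_lt hκ hA hT) r ?_ fun 𝓕₀ h𝓕 hf => ?_)
    · rintro F (⟨G, hG, δ, hδ, rfl⟩ | ⟨c, hc, rfl⟩)
      · exact (hG.mono Set.subset_union_left).comp₁ (c := fun s => |s - G ![x]| - δ) (by fun_prop)
      · exact (isDef_dist (Sum.inl 0) (Sum.inr ⟨c, Or.inr hc⟩)).comp₁ (c := fun s => η - s)
          (by fun_prop)
    · obtain ⟨z, hz, h⟩ := hcon 𝓕₀ h𝓕 hf
      exact ⟨![z], fun i => by simpa using hz, h⟩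
  obtain ⟨𝓕₀, h𝓕, hf, hz⟩ := hfin
  -- Only the type conditions enter `φ`, scaled by `1 / δ` so that `φ ≤ 1` expresses them. The
  -- distance conditions stay as hypotheses, because `T` need not lie in `A`.
  have key : ∀ 𝓕₁ : Set ((Fin 1 → H) → ℝ), 𝓕₁.Finite → 𝓕₁ ⊆ 𝓕 → ∃ φ : (Fin 1 → H) → ℝ,
      IsDef d A φ ∧ φ ![x] ≤ 0 ∧
      ∀ z, φ ![z] ≤ 1 → (∀ c ∈ T, η ≤ dist z c) → ∀ F ∈ 𝓕₁, F ![z] ≤ 0 := by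
    intro 𝓕₁ hf₁
    induction 𝓕₁, hf₁ using Set.Finite.induction_on with
    | empty => exact fun _ => ⟨_, isDef_const 0, le_rfl, by simp⟩
    | insert _ _ ih =>
      intro h
      obtain ⟨φ, hφ, hφx, hφz⟩ := ih ((Set.subset_insert _ _).trans h)
      rcases h (Set.mem_insert _ _) with ⟨G, hG, δ, hδ, rfl⟩ | ⟨c, hc, rfl⟩
      · refine ⟨_, hφ.comp₂ hG (c := fun p => max p.1 (|p.2 - G ![x]| / δ)) (by fun_prop), ?_, ?_⟩
        · simpa using hφx
        · intro z hz hzT F hF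
          rw [max_le_iff, div_le_one hδ] at hz
          rcases hF with rfl | hF
          · exact sub_nonpos.2 hz.2
          · exact hφz z hz.1 hzT F hF
      · refine ⟨φ, hφ, hφx, fun z hz hzT F hF => ?_⟩
        rcases hF with rfl | hF
        · exact sub_nonpos.2 (hzT c hc)
        · exact hφz z hz hzT F hF
  obtain ⟨φ, hφ, hφx, hφz⟩ := key 𝓕₀ hf h𝓕
  refine ⟨φ, hφ, hφx, fun z hzr hz1 => ?_⟩
  by_contra! hcon
  obtain ⟨F, hF, hpos⟩ := hz z hzr
  refine hpos.not_ge (hφz z hz1 (fun c hc => ?_) F hF)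
  rw [dist_eq_norm]
  exact hcon c (hTo hc)

end Saturation

/-! ### Finite nets and separated tuples -/

section Separation

variable {X : Type*} [PseudoMetricSpace X]

lemma exists_ne_dist_le_of_net {T : Set X} (hT : T.Finite) {η : ℝ}
    (w : Fin (hT.toFinset.card + 1) → X) (hw : ∀ i, ∃ c ∈ T, dist (w i) c ≤ η) :
    ∃ i j, i ≠ j ∧ dist (w i) (w j) ≤ 2 * η := by
  choose f hf hfd using hw
  obtain ⟨i, -, j, -, hij, h⟩ := Finset.exists_ne_map_eq_of_card_lt_of_maps_to
    (s := Finset.univ) (t := hT.toFinset) (f := f) (by simp) fun i _ => by simpa using hf i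
  refine ⟨i, j, hij, ?_⟩
  have h1 := hfd i
  have h2 := hfd j
  rw [← h] at h2
  linarith [dist_triangle_right (w i) (w j) (f i)]

/-- A separated tuple of maximal length is a net, since no further point can be added to it. -/
lemma exists_finite_net {s : Set X} {δ : ℝ} (k : ℕ)
    (h : ∀ w : Fin k → X, (∀ i, w i ∈ s) → ∃ i j, i ≠ j ∧ dist (w i) (w j) ≤ δ) :
    ∃ t : Set X, t.Finite ∧ ∀ z ∈ s, ∃ c ∈ t, dist z c ≤ δ := by
  induction k with
  | zero =>
    obtain ⟨i, -⟩ := h Fin.elim0 fun i => i.elim0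
    exact i.elim0
  | succ k ih =>
    by_cases hk : ∀ w : Fin k → X, (∀ i, w i ∈ s) → ∃ i j, i ≠ j ∧ dist (w i) (w j) ≤ δ
    · exact ih hk
    push Not at hk
    obtain ⟨w, hw, hsep⟩ := hk
    refine ⟨Set.range w, Set.finite_range w, fun z hz => ?_⟩
    obtain ⟨i, j, hij, hd⟩ := h (Fin.snoc (α := fun _ => X) w z) fun i => by
      refine Fin.lastCases ?_ (fun j => ?_) i
      · simpa using hz
      · simpa using hw j
    revert hij hd
    refine Fin.lastCases ?_ (fun i => ?_) i <;> refine Fin.lastCases ?_ (fun j => ?_) j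
    · exact fun hij => absurd rfl hij
    · intro _ hd
      exact ⟨w j, ⟨j, rfl⟩, by simpa using hd⟩
    · intro _ hd
      exact ⟨w i, ⟨i, rfl⟩, by simpa [dist_comm] using hd⟩
    · intro hij hd
      simp only [Fin.snoc_castSucc] at hd
      exact absurd hd (hsep i j fun h => hij (by rw [h])).not_ge

end Separation

/-! ### The formula witnessing dependence -/

section StrongFiniteCharacter

lemma IsSmall.union_range {X : Type u} [NormedAddCommGroup X] {κ : Cardinal.{u}} {A : Set X} {n : ℕ}
    (hκ : Cardinal.aleph0 < κ) (hA : IsSmall κ A) (a : Fin n → X) :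
    IsSmall κ (Set.range a ∪ A) := by
  obtain ⟨D, hDA, hAD, hD⟩ := hA
  refine ⟨D ∪ Set.range a, ?_, ?_, mk_union_finite_lt hκ hD (Set.finite_range a)⟩
  · rw [Set.union_comm]
    exact Set.union_subset_union_right _ hDA
  · refine Set.union_subset (Set.subset_union_right.trans subset_closure)
      (hAD.trans (closure_mono Set.subset_union_left))

variable {H : Type u} [NormedAddCommGroup H] [InnerProductSpace ℝ H] {d : H → ℝ}
  {κ : Cardinal.{u}} {A C : Set H} {n : ℕ}

lemma IsDef.iInf_le (hd : ∀ x, d x ∈ Set.Icc (0 : ℝ) 1) {F : (Fin (n + 1) → H) → ℝ}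
    (hF : IsDef d A F) {k : ℕ} (v : Fin n → H) {y : H} (hy : ‖y‖ ≤ k) :
    ⨅ y : Metric.closedBall (0 : H) k, F (Fin.snoc (α := fun _ => H) v y) ≤
      F (Fin.snoc (α := fun _ => H) v y) := by
  obtain ⟨M, hM⟩ := hF.exists_abs_snoc_le hd k v
  refine ciInf_le (f := fun y : Metric.closedBall (0 : H) k => F (Fin.snoc (α := fun _ => H) v y))
    ⟨-M, ?_⟩ ⟨y, by simpa using hy⟩
  rintro _ ⟨y, rfl⟩
  exact (abs_le.1 (hM y)).1

lemma exists_lt_of_iInf_ball_lt {H : Type*} [NormedAddCommGroup H] {F : H → ℝ} {k : ℕ} {r : ℝ}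
    (h : ⨅ y : Metric.closedBall (0 : H) k, F y < r) : ∃ y, ‖y‖ ≤ k ∧ F y < r := by
  obtain ⟨y, hy⟩ := exists_lt_of_ciInf_lt h
  exact ⟨y, mem_closedBall_zero_iff.1 y.2, hy⟩

/-- The condition on `v` that among any `k` points `z` of a ball with `F (v, z) < 1` there are two
with distance at most `δ`. -/
lemma isCond_not_separated (hd : ∀ x, d x ∈ Set.Icc (0 : ℝ) 1) {F : (Fin (n + 1) → H) → ℝ}
    (hF : IsDef d A F) (r k : ℕ) (δ : ℝ) :
    IsCond d A fun v : Fin n → H => ∀ w : Fin k → H, (∀ i, ‖w i‖ ≤ r) →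
      (∃ i, 1 ≤ F (Fin.snoc (α := fun _ => H) v (w i))) ∨
        ∃ p : {p : Fin k × Fin k // p.1 ≠ p.2}, dist (w p.1.1) (w p.1.2) ≤ δ := by
  have h1 : IsCond d A fun u : Fin (n + k) → H =>
      ∃ i : Fin k, 1 ≤ F fun j => assign u (Fin.snoc (α := fun _ => Fin (n + k) ⊕ A)
        (fun j : Fin n => Sum.inl (Fin.castAdd k j)) (Sum.inl (Fin.natAdd n i)) j) :=
    IsCond.exists_finite fun i => (hF.subst _).isCond_ge 1
  have h2 : IsCond d A fun u : Fin (n + k) → H =>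
      ∃ p : {p : Fin k × Fin k // p.1 ≠ p.2},
        dist (assign (A := A) u (Sum.inl (Fin.natAdd n p.1.1)))
          (assign (A := A) u (Sum.inl (Fin.natAdd n p.1.2))) ≤ δ :=
    IsCond.exists_finite fun p => (isDef_dist _ _).isCond_le δ
  have hsnoc : ∀ (v : Fin n → H) (w : Fin k → H) (i : Fin k),
      (fun j => assign (Fin.append v w) (Fin.snoc (α := fun _ => Fin (n + k) ⊕ A)
        (fun j : Fin n => Sum.inl (Fin.castAdd k j)) (Sum.inl (Fin.natAdd n i)) j)) =
      Fin.snoc (α := fun _ => H) v (w i) := by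
    intro v w i
    funext j
    refine Fin.lastCases ?_ (fun j => ?_) j <;> simp
  simpa only [hsnoc, assign_inl, Fin.append_right] using (h1.or h2).forall_ball_append hd r

/-- The condition combines approximate existence of `z`, `z'` near the two orbits with a bound on
separated solutions of `F`. The bound makes the orbit of `z` finite up to `4η`, and hence `z` close
to an algebraic vector. -/
lemma exists_isCond_inner_ne_zero [CompleteSpace H] (hd : ∀ x, d x ∈ Set.Icc (0 : ℝ) 1)
    (hκ : Cardinal.aleph0 < κ) (hs : IsSaturated d κ) (hh : IsStronglyHomogeneous d κ)
    (hAC : A ⊆ C) (hC : Cardinal.mk C < κ) {b : Fin n → H} {x c : H}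
    (hx : x ∈ almostPeriodic (autGroup d (Set.range b ∪ A)))
    (hc : c ∈ almostPeriodic (autGroup d C)) (hxc : 0 < inner ℝ x c) :
    ∃ P : (Fin n → H) → Prop, IsCond d C P ∧ P b ∧ ∀ a, P a →
      ∃ y ∈ almostPeriodic (autGroup d (Set.range a ∪ A)), ∃ c' ∈ orbit (autGroup d C) c,
        inner ℝ y c' ≠ 0 := by
  obtain ⟨r, hr⟩ := exists_nat_ge (max 1 (max ‖x‖ ‖c‖))
  have hr1 : (1 : ℝ) ≤ r := (le_max_left _ _).trans hr
  have hrx : ‖x‖ ≤ r := (le_max_left _ _).trans ((le_max_right _ _).trans hr)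
  have hrc : ‖c‖ ≤ r := (le_max_right _ _).trans ((le_max_right _ _).trans hr)
  set s : ℝ := inner ℝ x c with hsdef
  -- Replacing `z` by `y` costs at most `4ηr` and `z'` by `c'` at most `ηr`: in total `5s/16`, below
  -- the `s/2` that ⟪z, z'⟫ exceeds.
  set η : ℝ := s / (16 * r) with hηdef
  have hη : 0 < η := by positivity
  have hηr : η * r = s / 16 := by rw [hηdef]; field_simp
  have hbA : Cardinal.mk ↥(Set.range b ∪ A) < κ := by
    rw [Set.union_comm]
    exact mk_union_finite_lt hκ ((Cardinal.mk_le_mk_of_subset hAC).trans_lt hC) (Set.finite_range b)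
  obtain ⟨φ, hφ, hφx, hφn⟩ := exists_isDef_near_orbit hκ hs hh hbA hx r hη
  obtain ⟨θ, hθ, hθc, hθn⟩ := exists_isDef_near_orbit hκ hs hh hC hc r hη
  obtain ⟨F, hF, hFφ⟩ := hφ.exists_snoc
  obtain ⟨T, hT, hTcov⟩ := Metric.totallyBounded_iff.1 (mem_almostPeriodic.1 hx) η hη
  -- Points with `F < 1` over `b` are `η`-close to the orbit of `x`, hence `2η`-close to `T`; by
  -- pigeonhole two of `|T| + 1` are within `4η`.
  have hsep := isCond_not_separated hd (hF.mono hAC) r (hT.toFinset.card + 1) (2 * (2 * η))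
  let K : (Fin (n + 1 + 1) → H) → ℝ := fun v =>
    max (max (F fun i => v i.castSucc) (θ ![v (Fin.last _)]))
      (s - inner ℝ (v (Fin.last n).castSucc) (v (Fin.last _)))
  have hK : IsDef d C K := by
    have h1 := (hF.mono hAC).subst fun i : Fin (n + 1) =>
      (Sum.inl i.castSucc : Fin (n + 1 + 1) ⊕ C)
    have h2 := hθ.subst fun _ : Fin 1 => (Sum.inl (Fin.last _) : Fin (n + 1 + 1) ⊕ C)
    have h3 := isDef_inner (d := d) (Sum.inl (Fin.last n).castSucc : Fin (n + 1 + 1) ⊕ C)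
      (Sum.inl (Fin.last _))
    refine Eq.mp (congrArg _ ?_) ((h1.comp₂ h2 (c := fun p => max p.1 p.2) (by fun_prop)).comp₂ h3
      (c := fun p => max p.1 (s - p.2)) (by fun_prop))
    funext v
    simp only [assign_inl, K]
    rw [eq_vec_one fun _ : Fin 1 => v (Fin.last (n + 1))]
  have hKval : ∀ v z z', K (Fin.snoc (α := fun _ => H) (Fin.snoc (α := fun _ => H) v z) z') =
      max (max (F (Fin.snoc (α := fun _ => H) v z)) (θ ![z'])) (s - inner ℝ z z') := by
    intro v z z'
    simp [K]
  refine ⟨_, hsep.and (((hK.iInf r).iInf r).isCond_le 0), ⟨fun w hw => ?_, ?_⟩, ?_⟩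
  · by_contra! hcon
    obtain ⟨hw1, hwd⟩ := hcon
    obtain ⟨i, j, hij, hle⟩ := exists_ne_dist_le_of_net hT (η := 2 * η) w fun i => by
      have h1 := hw1 i
      rw [hFφ] at h1
      obtain ⟨y, hy, hwy⟩ := hφn _ (hw i) h1.le
      have h2 := hTcov hy
      simp only [Set.mem_iUnion, Metric.mem_ball, exists_prop] at h2
      obtain ⟨e, he, hye⟩ := h2
      rw [← dist_eq_norm] at hwy
      exact ⟨e, he, by linarith [dist_triangle (w i) y e]⟩
    exact (hwd ⟨(i, j), hij⟩).not_ge hle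
  · refine ((hK.iInf r).iInf_le hd b hrx).trans ((hK.iInf_le hd _ hrc).trans ?_)
    rw [hKval, hFφ]
    exact max_le (max_le hφx hθc) (by rw [hsdef, sub_self])
  · rintro a ⟨hasep, hainf⟩
    -- The infimum need not be attained; the gap between the values `0` and `1` of the isolating
    -- formulas leaves room for approximate witnesses.
    obtain ⟨z, hz, hlt⟩ := exists_lt_of_iInf_ball_lt
      (F := fun z => ⨅ z' : Metric.closedBall (0 : H) r,
        K (Fin.snoc (α := fun _ => H) (Fin.snoc (α := fun _ => H) a z) z'))
      (hainf.trans_lt (show 0 < min 1 (s / 2) by positivity))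
    obtain ⟨z', hz', hlt⟩ := exists_lt_of_iInf_ball_lt
      (F := fun z' => K (Fin.snoc (α := fun _ => H) (Fin.snoc (α := fun _ => H) a z) z')) hlt
    rw [hKval, max_lt_iff, max_lt_iff] at hlt
    obtain ⟨⟨hFz, hθz⟩, hin⟩ := hlt
    replace hFz := hFz.trans_le (min_le_left _ _)
    replace hθz := hθz.trans_le (min_le_left _ _)
    replace hin := hin.trans_le (min_le_right _ _)
    obtain ⟨c', hc', hzc'⟩ := hθn z' hz' hθz.le
    obtain ⟨t, ht, hnet⟩ := exists_finite_net (s := orbit (autGroup d (Set.range a ∪ A)) z) _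
      (δ := 2 * (2 * η)) fun w hw => by
        have hwr : ∀ i, ‖w i‖ ≤ r := fun i => by
          obtain ⟨g, -, h⟩ := hw i
          rwa [← h, g.norm_map]
        rcases hasep w hwr with ⟨i, hi⟩ | ⟨p, hp⟩
        · obtain ⟨g, hg, h⟩ := hw i
          have hga : (fun j => g (Fin.snoc (α := fun _ : Fin (n + 1) => H) a z j)) =
              Fin.snoc (α := fun _ => H) a (w i) := by
            funext j
            refine Fin.lastCases ?_ (fun j => ?_) j
            · simpa using h
            · simpa using hg.2 (a j) (Or.inl ⟨j, rfl⟩)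
          -- `F` has parameters in `A` only, so its value is constant along the orbit of `z` over
          -- `Aa`; the alternative `1 ≤ F` is excluded.
          rw [← hga, hF.map (autGroup_anti d Set.subset_union_right hg)] at hi
          exact absurd hFz hi.not_gt
        · exact ⟨p.1.1, p.1.2, p.2, hp⟩
    obtain ⟨y, hy, hzy⟩ := exists_almostPeriodic_near (G := autGroup d (Set.range a ∪ A)) (x := z)
      (ε := 2 * (2 * η)) (by positivity) ht fun g hg => by
        simpa only [dist_eq_norm] using hnet _ ⟨g, hg, rfl⟩
    refine ⟨y, hy, c', hc', ?_⟩
    have hnc' : ‖c'‖ ≤ r := by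
      obtain ⟨g, -, rfl⟩ := hc'
      rwa [g.norm_map]
    have h1 : inner ℝ z z' = inner ℝ y c' + inner ℝ (z - y) c' + inner ℝ z (z' - c') := by
      rw [inner_sub_left, inner_sub_right]
      ring
    have h2 : inner ℝ (z - y) c' ≤ 2 * (2 * η) * r := (real_inner_le_norm _ _).trans (by gcongr)
    have h3 : inner ℝ z (z' - c') ≤ r * η := (real_inner_le_norm _ _).trans (by gcongr)
    refine ne_of_gt ?_
    nlinarith

lemma proj_eq_starProjection [CompleteSpace H] {S : Set H} {M : Submodule ℝ H}
    [M.HasOrthogonalProjection] (hM : IsClosed (M : Set H)) (hS : S = M) (x : H) : proj S x = M.starProjection x := by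
  subst hS
  have : (Submodule.span ℝ (M : Set H)).topologicalClosure = M := by
    rw [Submodule.span_eq, hM.submodule_topologicalClosure_eq]
  unfold proj
  simp only [this]

/-- The difference `c` of the two projections works: ⟪x, c⟫ = ‖c‖². -/
lemma exists_inner_pos_of_starProjection_ne {M N : Submodule ℝ H} [M.HasOrthogonalProjection]
    [N.HasOrthogonalProjection] (hMN : M ≤ N) {x : H}
    (hx : N.starProjection x ≠ M.starProjection x) :
    ∃ c ∈ N, c ∈ Mᗮ ∧ 0 < inner ℝ x c := by
  have hcN : N.starProjection x - M.starProjection x ∈ N :=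
    N.sub_mem (N.starProjection_apply_mem x) (hMN (M.starProjection_apply_mem x))
  have hcM : N.starProjection x - M.starProjection x ∈ Mᗮ := by
    have h := Mᗮ.sub_mem (M.sub_starProjection_mem_orthogonal x)
      (Submodule.orthogonal_le hMN (N.sub_starProjection_mem_orthogonal x))
    rwa [sub_sub_sub_cancel_left] at h
  refine ⟨_, hcN, hcM, ?_⟩
  have h1 := N.starProjection_inner_eq_zero x _ hcN
  have h2 := Submodule.inner_right_of_mem_orthogonal (M.starProjection_apply_mem x) hcM
  have h3 : inner ℝ x (N.starProjection x - M.starProjection x) =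
      inner ℝ (N.starProjection x - M.starProjection x)
        (N.starProjection x - M.starProjection x) := by
    rw [inner_sub_left] at h1
    rw [inner_sub_left (N.starProjection x), h2]
    linarith
  rw [h3]
  exact real_inner_self_pos.2 (sub_ne_zero.2 hx)

end StrongFiniteCharacter

end HilbertGeneric

theorem mainTheorem6 {H : Type u} [NormedAddCommGroup H] [InnerProductSpace ℝ H]
    [CompleteSpace H] (d : H → ℝ) (κ : Cardinal.{u})
    (hH : HilbertGeneric.IsUniversalDomain d κ)
    (A C : Set H) (hAC : A ⊆ C) (hA : HilbertGeneric.IsSmall κ A)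
    (hC : HilbertGeneric.IsSmall κ C) (n : ℕ) (b : Fin n → H)
    (hb : ¬ HilbertGeneric.StarIndep d A (Set.range b) C) :
    ∃ χ : HilbertGeneric.ParamFormula C n, χ ∈ HilbertGeneric.tpN d C b ∧
      ∀ a : Fin n → H, HilbertGeneric.Realizes d a χ →
        ¬ HilbertGeneric.StarIndep d A (Set.range a) C := by
  open HilbertGeneric in
  have hκ : Cardinal.aleph0 < κ := Cardinal.aleph0_lt_continuum.trans hH.continuum_lt
  have hs := hH.saturated
  have hh := hH.homogeneous
  have hd := hH.model.1.1.mem_Icc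
  have hclM := isClosed_almostPeriodic (autGroup d A)
  have hclN := isClosed_almostPeriodic (autGroup d C)
  have : CompleteSpace (almostPeriodic (autGroup d A)) := hclM.completeSpace_coe
  have : CompleteSpace (almostPeriodic (autGroup d C)) := hclN.completeSpace_coe
  have haclb := fun a : Fin n → H => aclN_eq_almostPeriodic hκ hs hh (hA.union_range hκ a)
  have hindep : ∀ a : Fin n → H, StarIndep d A (Set.range a) C ↔
      ∀ x ∈ almostPeriodic (autGroup d (Set.range a ∪ A)),
        (almostPeriodic (autGroup d C)).starProjection x =
          (almostPeriodic (autGroup d A)).starProjection x := by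
    intro a
    unfold StarIndep
    rw [haclb a, Set.union_eq_self_of_subset_left hAC]
    simp only [proj_eq_starProjection hclN (aclN_eq_almostPeriodic hκ hs hh hC),
      proj_eq_starProjection hclM (aclN_eq_almostPeriodic hκ hs hh hA), SetLike.mem_coe]
  have hle := almostPeriodic_anti (autGroup_anti d hAC)
  rw [hindep] at hb
  push Not at hb
  obtain ⟨x, hx, hxne⟩ := hb
  obtain ⟨c, hcN, hcM, hxc⟩ := exists_inner_pos_of_starProjection_ne hle hxne
  obtain ⟨D, hDA, hAD, hD⟩ := hA
  obtain ⟨E, hEC, hCE, hE⟩ := hC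
  have hAgrp : ∀ a : Fin n → H, autGroup d (Set.range a ∪ A) = autGroup d (Set.range a ∪ D) :=
    fun a => autGroup_eq_of_dense d (Set.union_subset_union_right _ hDA) (Set.union_subset
      (Set.subset_union_left.trans subset_closure)
      (hAD.trans (closure_mono Set.subset_union_right)))
  -- Saturation needs parameter sets of cardinality below `κ`; adding `D` to the dense set `E` keeps
  -- the parameters of `F` inside.
  have hCgrp : autGroup d C = autGroup d (E ∪ D) :=
    autGroup_eq_of_dense d (Set.union_subset hEC (hDA.trans hAC))
      (hCE.trans (closure_mono Set.subset_union_left))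
  have hcard : Cardinal.mk ↥(E ∪ D) < κ :=
    (Cardinal.mk_union_le E D).trans_lt (Cardinal.add_lt_of_lt hκ.le hE hD)
  obtain ⟨P, ⟨F, hF, hFP⟩, hPb, hPa⟩ := exists_isCond_inner_ne_zero hd hκ hs hh
    (Set.subset_union_right : D ⊆ E ∪ D) hcard (hAgrp b ▸ hx) (hCgrp ▸ hcN) hxc
  obtain ⟨χ, hχ⟩ := ((hF.mono (Set.union_subset hEC (hDA.trans hAC))).comp₁
    (c := fun r => max 0 r) (by fun_prop)).exists_paramFormula
  have hχP : ∀ a, Realizes d a χ ↔ P a := fun a => by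
    rw [Realizes, hχ, max_eq_left_iff, hFP]
  refine ⟨χ, (hχP b).2 hPb, fun a ha hind => ?_⟩
  obtain ⟨y, hy, c', hc', hne⟩ := hPa a ((hχP a).1 ha)
  rw [← hAgrp] at hy
  rw [← hCgrp] at hc'
  obtain ⟨g, hg, rfl⟩ := hc'
  -- The conjugate `g c` still lies in acl(C) and is orthogonal to acl(A), so independence would
  -- give ⟪y, g c⟫ = 0.
  have h1 := (almostPeriodic (autGroup d C)).starProjection_inner_eq_zero y _
    (apply_mem_almostPeriodic hg hcN)
  rw [(hindep a).1 hind y hy, inner_sub_left, Submodule.inner_right_of_mem_orthogonal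
    (Submodule.starProjection_apply_mem _ y)
    (apply_mem_orthogonal_almostPeriodic (autGroup_anti d hAC hg) hcM), sub_zero] at h1
  exact hne h1
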